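/- Let $\mathcal H$ be a separable complex Hilbert space with a fixed orthogonal decomposition $\mathcal H=\mathcal H_+\oplus\mathcal H_-$ into infinite-dimensional closed subspaces. Let $\mathcal L$ be the set of orthogonal projections of $\mathcal H$ (identified with the closed subspaces of $\mathcal H$), with the real smooth Banach manifold structure given by the graph charts: at $W\in\mathcal L$ the chart is defined on $\{V : V\oplus W^\perp=\mathcal H\}$ and sends $V$ to the bounded operator $P_{W^\perp}(P_W|_V)^{-1}\in L^\infty(W,W^\perp)$ whose graph is $V$. Let $\mathfrak U(\mathcal H)\rightrightarrows\mathcal L$ be the groupoid of all partial isometries of $\mathcal H$, with source $u^*u$, target $uu^*$, the product of operators, units the projections and inversion $u\mapsto u^*$. Its manifold structure has around $u_0$, with initial space $W$ and final space $W'$, the chart consisting of the graph coordinates in $L^\infty(W',W'^\perp)$ and $L^\infty(W,W^\perp)$ of the final and initial space of $u$, and of a chart of the Banach Lie group of unitaries of $W$, with values in the bounded skew-adjoint operators on $W$, applied to $u_0^*\,\sigma_{W'}(uu^*)^*\,u\,\sigma_W(u^*u)$; here $\sigma_W(V)$ is the unitary $W\to V$ given by the polar decomposition of $1_W+A:W\to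 V$, $A$ being the graph coordinate of $V$. Let $\mathrm{Gr}^0_{\rm res}\subset\mathcal L$ be the set of closed subspaces $W$ for which the orthogonal projection $W\to\mathcal H_+$ is Fredholm and the orthogonal projection $W\to\mathcal H_-$ is compact, and let $\mathfrak U^0_{\rm res}$ be the set of partial isometries whose initial and final spaces belong to $\mathrm{Gr}^0_{\rm res}$. Give $\mathrm{Gr}^0_{\rm res}$ and $\mathfrak U^0_{\rm res}$ the manifold structures defined by the same charts at their points, with the graph coordinates now taken in the spaces of compact operators $L^0(W,W^\perp)$ with the operator norm, instead of $L^\infty(W,W^\perp)$. An injective smooth map between Banach manifolds makes its domain an immersed submanifold if all its tangent maps are injective with closed range, and a split immersed submanifold if moreover all these ranges are complemented. Proposition. With these structures $\mathfrak U(\mathcal H)\rightrightarrows\mathcal L$ and $\mathfrak U^0_{\rm res}\rightrightarrows\mathrm{Gr}^0_{\rm res}$ are Banach Lie groupoids (Hausdorff Banach manifolds, with source and target surjective submersions, multiplication smooth, identity section a topological embedding, and inversion a diffeomorphism), and the inclusion is a morphism of groupoids. Both inclusions $\mathfrak U^0_{\rm res}\subset\mathfrak U(\mathcal H)$ and $\mathrm{Gr}^0_{\rm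 res}\subset\mathcal L$ are immersed submanifolds, and neither of them is a split immersed submanifold. -/

import Mathlib

open scoped ContDiff

universe u

noncomputable section

/-! ### Banach manifolds given by an atlas whose charts may take values in different Banach spaces

The Grassmannian of all closed subspaces is not modelled on a single Banach space, so charts carry
their own model space. All manifolds are real. -/

/-- A chart on a set `M`: a subset of `M` together with a map to a real Banach space
(only the values on `source` matter). -/
structure BanachChart (M : Type u) where
  /-- the Banach space in which the chart takes its values -/
  model : Type u
  [normedAddCommGroup : NormedAddCommGroup model]
  [normedSpace : NormedSpace ℝ model]
  [completeSpace : CompleteSpace model]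
  /-- the domain of the chart -/
  source : Set M
  /-- the coordinate map -/
  toFun : M → model

attribute [instance] BanachChart.normedAddCommGroup BanachChart.normedSpace
  BanachChart.completeSpace

section Manifold

variable {M N : Type u} {ι κ : Type u}

/-- The map `f : M → N` read in the charts `φ` and `ψ`, that is `ψ ∘ f ∘ φ⁻¹` on `φ(source φ)`,
and `0` elsewhere. -/
def localRep (φ : BanachChart M) (ψ : BanachChart N) (f : M → N) : φ.model → ψ.model :=
  Function.extend (fun x : φ.source => φ.toFun x) (fun x => ψ.toFun (f x)) 0

/-- The part of the image of the chart `φ` on which the local representative of `f` with respect to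
`φ`, `ψ` is defined. -/
def localDomain (φ : BanachChart M) (ψ : BanachChart N) (f : M → N) : Set φ.model :=
  φ.toFun '' (φ.source ∩ f ⁻¹' ψ.source)

/-- The topology defined by an atlas: it is generated by the preimages of open subsets of the model
spaces under the charts. -/
@[reducible] def atlasTopology (A : ι → BanachChart M) : TopologicalSpace M :=
  TopologicalSpace.generateFrom
    {S | ∃ i, ∃ O : Set (A i).model, IsOpen O ∧ S = (A i).source ∩ (A i).toFun ⁻¹' O}

/-- A family of charts is a smooth atlas of a Hausdorff Banach manifold: the chart domains cover,
the charts are injective with open images of overlaps (in particular, with `i = j`, open images),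
and the transition maps are smooth. -/
structure IsBanachManifold (A : ι → BanachChart M) : Prop where
  covers : ∀ x, ∃ i, x ∈ (A i).source
  injOn : ∀ i, Set.InjOn (A i).toFun (A i).source
  isOpen_overlap : ∀ i j, IsOpen (localDomain (A i) (A j) id)
  contDiffOn_transition : ∀ i j,
    ContDiffOn ℝ ∞ (localRep (A i) (A j) id) (localDomain (A i) (A j) id)
  t2 : @T2Space M (atlasTopology A)

/-- Smooth maps between Banach manifolds. Openness of the domains of the local representatives is
the continuity of the map. -/
def IsSmoothMap (A : ι → BanachChart M) (B : κ → BanachChart N) (f : M → N) : Prop :=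
  ∀ i j, IsOpen (localDomain (A i) (B j) f) ∧
    ContDiffOn ℝ ∞ (localRep (A i) (B j) f) (localDomain (A i) (B j) f)

/-- The tangent map of `f` at `x`, read in the charts `φ` around `x` and `ψ` around `f x`. -/
def tangentRep (φ : BanachChart M) (ψ : BanachChart N) (f : M → N) (x : M) :
    φ.model →L[ℝ] ψ.model :=
  fderiv ℝ (localRep φ ψ f) (φ.toFun x)

/-- Submersions: all tangent maps are onto, with split kernel. -/
def IsSubmersion (A : ι → BanachChart M) (B : κ → BanachChart N) (f : M → N) : Prop :=
  IsSmoothMap A B f ∧ ∀ x i j, x ∈ (A i).source → f x ∈ (B j).source →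
    Function.Surjective (tangentRep (A i) (B j) f x) ∧
      (LinearMap.ker (tangentRep (A i) (B j) f x : (A i).model →ₗ[ℝ] (B j).model)).ClosedComplemented

/-- `f` makes `M` an immersed submanifold of `N`: it is injective and smooth, and all its tangent
maps are injective with closed range. -/
def IsImmersedSubmanifold (A : ι → BanachChart M) (B : κ → BanachChart N) (f : M → N) : Prop :=
  Function.Injective f ∧ IsSmoothMap A B f ∧
    ∀ x i j, x ∈ (A i).source → f x ∈ (B j).source →
      Function.Injective (tangentRep (A i) (B j) f x) ∧
        IsClosed (Set.range (tangentRep (A i) (B j) f x))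

/-- `f` makes `M` a split immersed submanifold of `N`: moreover the ranges of all tangent maps
are complemented. -/
def IsSplitImmersedSubmanifold (A : ι → BanachChart M) (B : κ → BanachChart N) (f : M → N) :
    Prop :=
  IsImmersedSubmanifold A B f ∧
    ∀ x i j, x ∈ (A i).source → f x ∈ (B j).source →
      (LinearMap.range
        (tangentRep (A i) (B j) f x : (A i).model →ₗ[ℝ] (B j).model)).ClosedComplemented

end Manifold

/-! ### Banach Lie groupoids -/

/-- A groupoid with set of arrows `G` and set of objects `M`; `mul g h` is defined when
`s g = t h`. -/
structure SetGroupoid (G M : Type u) where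
  /-- source -/
  s : G → M
  /-- target -/
  t : G → M
  /-- identity section -/
  unit : M → G
  /-- inversion -/
  inv : G → G
  /-- multiplication of composable arrows -/
  mul : (g h : G) → s g = t h → G
  s_mul : ∀ g h e, s (mul g h e) = s h
  t_mul : ∀ g h e, t (mul g h e) = t g
  mul_assoc : ∀ g h k (e : s g = t h) (e' : s h = t k),
    mul (mul g h e) k ((s_mul g h e).trans e') = mul g (mul h k e') (e.trans (t_mul h k e').symm)
  s_unit : ∀ x, s (unit x) = x
  t_unit : ∀ x, t (unit x) = x
  mul_unit : ∀ g, mul g (unit (s g)) (t_unit _).symm = g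
  unit_mul : ∀ g, mul (unit (t g)) g (s_unit _) = g
  s_inv : ∀ g, s (inv g) = t g
  t_inv : ∀ g, t (inv g) = s g
  mul_inv : ∀ g, mul g (inv g) (t_inv g).symm = unit (t g)
  inv_mul : ∀ g, mul (inv g) g (s_inv g) = unit (s g)

namespace SetGroupoid

variable {G M G' M' : Type u} {ι κ : Type u}

/-- The full subgroupoid `s⁻¹(S) ∩ t⁻¹(S) ⇉ S` over a subset `S` of the base. -/
def restrict (𝒢 : SetGroupoid G M) (S : Set M) :
    SetGroupoid {g : G // 𝒢.s g ∈ S ∧ 𝒢.t g ∈ S} {x : M // x ∈ S} where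
  s g := ⟨𝒢.s g, g.2.1⟩
  t g := ⟨𝒢.t g, g.2.2⟩
  unit x := ⟨𝒢.unit x, by rw [𝒢.s_unit]; exact x.2, by rw [𝒢.t_unit]; exact x.2⟩
  inv g := ⟨𝒢.inv g, by rw [𝒢.s_inv]; exact g.2.2, by rw [𝒢.t_inv]; exact g.2.1⟩
  mul g h e := ⟨𝒢.mul g h (congrArg Subtype.val e),
    by rw [𝒢.s_mul]; exact h.2.1, by rw [𝒢.t_mul]; exact g.2.2⟩
  s_mul _ _ _ := Subtype.ext (𝒢.s_mul _ _ _)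
  t_mul _ _ _ := Subtype.ext (𝒢.t_mul _ _ _)
  mul_assoc _ _ _ _ _ := Subtype.ext (𝒢.mul_assoc _ _ _ _ _)
  s_unit _ := Subtype.ext (𝒢.s_unit _)
  t_unit _ := Subtype.ext (𝒢.t_unit _)
  mul_unit _ := Subtype.ext (𝒢.mul_unit _)
  unit_mul _ := Subtype.ext (𝒢.unit_mul _)
  s_inv _ := Subtype.ext (𝒢.s_inv _)
  t_inv _ := Subtype.ext (𝒢.t_inv _)
  mul_inv _ := Subtype.ext (𝒢.mul_inv _)
  inv_mul _ := Subtype.ext (𝒢.inv_mul _)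

/-- `F` on arrows and `f` on objects form a morphism of groupoids. -/
structure IsHom (𝒢 : SetGroupoid G M) (ℋ : SetGroupoid G' M') (F : G → G') (f : M → M') :
    Prop where
  map_s : ∀ g, ℋ.s (F g) = f (𝒢.s g)
  map_t : ∀ g, ℋ.t (F g) = f (𝒢.t g)
  map_unit : ∀ x, F (𝒢.unit x) = ℋ.unit (f x)
  map_inv : ∀ g, F (𝒢.inv g) = ℋ.inv (F g)
  map_mul : ∀ g h (e : 𝒢.s g = 𝒢.t h) (e' : ℋ.s (F g) = ℋ.t (F h)),
    F (𝒢.mul g h e) = ℋ.mul (F g) (F h) e'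

/-- The multiplication is smooth on the set of composable pairs, a subset of the manifold `G × G`:
in charts it is locally the restriction of a smooth map defined on an open set. -/
def IsSmoothMul (𝒢 : SetGroupoid G M) (A : ι → BanachChart G) : Prop :=
  ∀ (g h : G) (e : 𝒢.s g = 𝒢.t h) (i j k : ι),
    g ∈ (A i).source → h ∈ (A j).source → 𝒢.mul g h e ∈ (A k).source →
    ∃ (O : Set ((A i).model × (A j).model)) (F : (A i).model × (A j).model → (A k).model),
      IsOpen O ∧ ((A i).toFun g, (A j).toFun h) ∈ O ∧ ContDiffOn ℝ ∞ F O ∧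
      ∀ (g' h' : G) (e' : 𝒢.s g' = 𝒢.t h'), g' ∈ (A i).source → h' ∈ (A j).source →
        ((A i).toFun g', (A j).toFun h') ∈ O →
        𝒢.mul g' h' e' ∈ (A k).source ∧
          (A k).toFun (𝒢.mul g' h' e') = F ((A i).toFun g', (A j).toFun h')

/-- A groupoid with manifold structures on arrows (atlas `A`) and objects (atlas `B`) is a
(Hausdorff) Banach Lie groupoid. As the inversion is an involution, it is a diffeomorphism as soon
as it is smooth. -/
structure IsBanachLieGroupoid (𝒢 : SetGroupoid G M) (A : ι → BanachChart G)
    (B : κ → BanachChart M) : Prop where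
  manifold_arrows : IsBanachManifold A
  manifold_objects : IsBanachManifold B
  surjective_s : Function.Surjective 𝒢.s
  surjective_t : Function.Surjective 𝒢.t
  submersion_s : IsSubmersion A B 𝒢.s
  submersion_t : IsSubmersion A B 𝒢.t
  smooth_mul : 𝒢.IsSmoothMul A
  embedding_unit : @Topology.IsEmbedding M G (atlasTopology B) (atlasTopology A) 𝒢.unit
  bijective_inv : Function.Bijective 𝒢.inv
  smooth_inv : IsSmoothMap A A 𝒢.inv

end SetGroupoid

/-! ### The groupoid of partial isometries over the lattice of projections -/

section Hilbert

variable (H : Type u) [NormedAddCommGroup H] [InnerProductSpace ℂ H] [CompleteSpace H]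

/-- The set of orthogonal projections of `H`; a projection is identified with the closed
subspace that is its range. -/
abbrev Proj : Type u := {p : H →L[ℂ] H // IsStarProjection p}

/-- The set of partial isometries of `H`: operators `u` such that `u* u` is a projection. -/
abbrev PIso : Type u := {u : H →L[ℂ] H // IsStarProjection (star u * u)}

variable {H}

theorem PIso.mul_star_mul (v : PIso H) : v.1 * (star v.1 * v.1) = v.1 := by
  have h := v.2.isIdempotentElem.eq
  have h0 : star (v.1 - v.1 * (star v.1 * v.1)) * (v.1 - v.1 * (star v.1 * v.1)) = 0 := by
    have e : star (v.1 - v.1 * (star v.1 * v.1)) * (v.1 - v.1 * (star v.1 * v.1))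
        = star v.1 * v.1 - star v.1 * v.1 * (star v.1 * v.1) - star v.1 * v.1 * (star v.1 * v.1)
          + star v.1 * v.1 * (star v.1 * v.1) * (star v.1 * v.1) := by
      simp only [star_sub, star_mul, star_star]
      noncomm_ring
    rw [e, h, h]
    abel
  have := CStarRing.star_mul_self_eq_zero_iff _ |>.1 h0
  exact (sub_eq_zero.1 this).symm

theorem PIso.isStarProjection_mul_star (v : PIso H) : IsStarProjection (v.1 * star v.1) where
  isIdempotentElem := by
    have h := v.mul_star_mul
    change v.1 * star v.1 * (v.1 * star v.1) = v.1 * star v.1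
    calc v.1 * star v.1 * (v.1 * star v.1) = v.1 * (star v.1 * v.1) * star v.1 := by
          simp only [mul_assoc]
      _ = _ := by rw [h]
  isSelfAdjoint := by simp [IsSelfAdjoint]

/-- The source `u* u` of a partial isometry (the projection onto its initial space). -/
def PIso.src (v : PIso H) : Proj H := ⟨star v.1 * v.1, v.2⟩

/-- The target `u u*` of a partial isometry (the projection onto its final space). -/
def PIso.tgt (v : PIso H) : Proj H := ⟨v.1 * star v.1, v.isStarProjection_mul_star⟩

theorem Proj.mul_self (p : Proj H) : p.1 * p.1 = p.1 := p.2.isIdempotentElem.eq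

theorem Proj.star_eq (p : Proj H) : star p.1 = p.1 := p.2.isSelfAdjoint.star_eq

variable (H) in
/-- The groupoid of partial isometries of `H` over the lattice of orthogonal projections, with
source `u* u`, target `u u*`, product of operators, units the projections, and inverse `u*`. -/
def partialIsometryGroupoid : SetGroupoid (PIso H) (Proj H) where
  s := PIso.src
  t := PIso.tgt
  unit p := ⟨p.1, by rw [p.star_eq, p.mul_self]; exact p.2⟩
  inv v := ⟨star v.1, by rw [star_star]; exact v.isStarProjection_mul_star⟩
  mul v w e := ⟨v.1 * w.1, by
    have e' : star v.1 * v.1 = w.1 * star w.1 := congrArg Subtype.val e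
    have : star (v.1 * w.1) * (v.1 * w.1) = star w.1 * w.1 := by
      calc star (v.1 * w.1) * (v.1 * w.1) = star w.1 * (star v.1 * v.1) * w.1 := by
            simp only [star_mul, mul_assoc]
        _ = star w.1 * (w.1 * (star w.1 * w.1)) := by rw [e']; simp only [mul_assoc]
        _ = _ := by rw [w.mul_star_mul]
    rw [this]; exact w.2⟩
  s_mul v w e := Subtype.ext <| by
    have e' : star v.1 * v.1 = w.1 * star w.1 := congrArg Subtype.val e
    change star (v.1 * w.1) * (v.1 * w.1) = star w.1 * w.1
    calc star (v.1 * w.1) * (v.1 * w.1) = star w.1 * (star v.1 * v.1) * w.1 := by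
            simp only [star_mul, mul_assoc]
        _ = star w.1 * (w.1 * (star w.1 * w.1)) := by rw [e']; simp only [mul_assoc]
        _ = _ := by rw [w.mul_star_mul]
  t_mul v w e := Subtype.ext <| by
    have e' : star v.1 * v.1 = w.1 * star w.1 := congrArg Subtype.val e
    change v.1 * w.1 * star (v.1 * w.1) = v.1 * star v.1
    calc v.1 * w.1 * star (v.1 * w.1) = v.1 * (w.1 * star w.1) * star v.1 := by
            simp only [star_mul, mul_assoc]
        _ = v.1 * (star v.1 * v.1) * star v.1 := by rw [e']
        _ = _ := by rw [v.mul_star_mul]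
  mul_assoc v w x _ _ := Subtype.ext (_root_.mul_assoc v.1 w.1 x.1)
  s_unit p := Subtype.ext <| by
    change star p.1 * p.1 = p.1
    rw [p.star_eq, p.mul_self]
  t_unit p := Subtype.ext <| by
    change p.1 * star p.1 = p.1
    rw [p.star_eq, p.mul_self]
  mul_unit v := Subtype.ext v.mul_star_mul
  unit_mul v := Subtype.ext <| by
    change v.1 * star v.1 * v.1 = v.1
    rw [_root_.mul_assoc, v.mul_star_mul]
  s_inv v := Subtype.ext <| by
    change star (star v.1) * star v.1 = v.1 * star v.1
    rw [star_star]
  t_inv v := Subtype.ext <| by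
    change star v.1 * star (star v.1) = star v.1 * v.1
    rw [star_star]
  mul_inv v := rfl
  inv_mul v := rfl

/-! ### Charts

For a projection `p` with range `W`, operators `W → Wᗮ` are identified with the operators `A` on `H`
such that `(1 - p) A p = A`, and operators on `W` with the operators `X` such that `p X p = X`. -/

/-- The space of bounded operators `W → Wᗮ`, where `W` is the range of `p`. -/
def offDiag (p : Proj H) : Submodule ℝ (H →L[ℂ] H) where
  carrier := {A | (1 - p.1) * A * p.1 = A}
  add_mem' {A B} hA hB := by
    have hA : (1 - p.1) * A * p.1 = A := hA
    have hB : (1 - p.1) * B * p.1 = B := hB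
    change (1 - p.1) * (A + B) * p.1 = A + B
    rw [mul_add, add_mul, hA, hB]
  zero_mem' := by simp
  smul_mem' c A hA := by
    have hA : (1 - p.1) * A * p.1 = A := hA
    change (1 - p.1) * (c • A) * p.1 = c • A
    rw [mul_smul_comm, smul_mul_assoc, hA]

/-- The space of compact operators `W → Wᗮ` with the operator norm, where `W` is the range
of `p`. -/
def compactOffDiag (p : Proj H) : Submodule ℝ (H →L[ℂ] H) :=
  offDiag p ⊓ (compactOperator (RingHom.id ℂ) H H).restrictScalars ℝ

/-- The space of bounded skew-adjoint operators on the range of `p`. -/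
def skewCorner (p : Proj H) : Submodule ℝ (H →L[ℂ] H) where
  carrier := {X | star X = -X ∧ p.1 * X * p.1 = X}
  add_mem' {X Y} hX hY := by
    refine ⟨?_, ?_⟩
    · rw [star_add, hX.1, hY.1, neg_add]
    · rw [mul_add, add_mul, hX.2, hY.2]
  zero_mem' := by simp
  smul_mem' c X hX := by
    refine ⟨?_, ?_⟩
    · rw [star_smul, hX.1, star_trivial, smul_neg]
    · rw [mul_smul_comm, smul_mul_assoc, hX.2]

theorem isClosed_offDiag (p : Proj H) : IsClosed (offDiag p : Set (H →L[ℂ] H)) :=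
  isClosed_eq (f := fun A : H →L[ℂ] H => (1 - p.1) * A * p.1) (g := fun A => A)
    (by fun_prop) continuous_id

theorem isClosed_compactOffDiag (p : Proj H) :
    IsClosed (compactOffDiag p : Set (H →L[ℂ] H)) :=
  (isClosed_offDiag p).inter
    (isClosed_setOfPred_isCompactOperator (σ₁₂ := RingHom.id ℂ) (M₁ := H) (M₂ := H))

theorem isClosed_skewCorner (p : Proj H) : IsClosed (skewCorner p : Set (H →L[ℂ] H)) :=
  (isClosed_eq (f := fun A : H →L[ℂ] H => star A) (g := fun A => -A)
    continuous_star continuous_neg).inter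
    (isClosed_eq (f := fun A : H →L[ℂ] H => p.1 * A * p.1) (g := fun A => A)
      (by fun_prop) continuous_id)

instance (p : Proj H) : CompleteSpace (offDiag p) := (isClosed_offDiag p).completeSpace_coe

instance (p : Proj H) : CompleteSpace (compactOffDiag p) :=
  (isClosed_compactOffDiag p).completeSpace_coe

instance (p : Proj H) : CompleteSpace (skewCorner p) := (isClosed_skewCorner p).completeSpace_coe

/-- The domain of the graph chart at `W = range p`: closed subspaces `V` with `V ⊕ Wᗮ = H`
(direct sum of Banach spaces, not necessarily orthogonal). -/
def graphDomain (p : Proj H) : Set (Proj H) :=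
  {q | IsCompl (LinearMap.range (q.1 : H →ₗ[ℂ] H)) (LinearMap.range (p.1 : H →ₗ[ℂ] H))ᗮ}

/-- The graph coordinate `(1 - p) q p (p q p)⁻¹` of a projection `q`, the inverse of `p q p` being
taken in the operators on `W = range p`. For `q` in `graphDomain p` with range `V` this is the
operator `P_{Wᗮ} (P_W|_V)⁻¹ : W → Wᗮ` whose graph is `V`. -/
def graphCoord (p q : Proj H) : H →L[ℂ] H :=
  (1 - p.1) * q.1 * p.1 * Ring.inverse (p.1 * q.1 * p.1 + (1 - p.1)) * p.1

theorem graphCoord_mem (p q : Proj H) : graphCoord p q ∈ offDiag p := by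
  change (1 - p.1) * graphCoord p q * p.1 = graphCoord p q
  have h1 : (1 - p.1) * (1 - p.1) = 1 - p.1 := p.2.one_sub.isIdempotentElem.eq
  have h2 := p.mul_self
  unfold graphCoord
  simp only [mul_assoc, h2]
  simp only [← mul_assoc, h1]

/-- The graph chart of the Grassmannian at `p`. -/
def grassmannianChart (p : Proj H) : BanachChart (Proj H) where
  model := offDiag p
  source := graphDomain p
  toFun q := ⟨graphCoord p q, graphCoord_mem p q⟩

variable (H) in
/-- The atlas of the Grassmannian of all closed subspaces of `H`. -/
def grassmannianAtlas : Proj H → BanachChart (Proj H) := grassmannianChart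

/-- The local cross-section of the Grassmannian at `W = range p`: for `q` in `graphDomain p` with
range `V` and graph coordinate `A`, this is the partial isometry `(1_W + A) (1 + A* A)^{-1/2}` with
initial space `W` and final space `V`, the unitary part of the isomorphism `1_W + A : W → V`. -/
def crossSection (p q : Proj H) : H →L[ℂ] H :=
  (p.1 + graphCoord p q) *
    CFC.sqrt (Ring.inverse (1 + star (graphCoord p q) * graphCoord p q)) * p.1

/-- For `v` near `u₀`, the operator `u₀* σ(v v*)* v σ(v* v)`, which is unitary on the initial space
of `u₀`. Here `σ` are the cross-sections at the target and at the source of `u₀`. -/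
def unitaryPart (u₀ v : PIso H) : H →L[ℂ] H :=
  star u₀.1 * star (crossSection u₀.tgt v.tgt) * v.1 * crossSection u₀.src v.src

/-- The Cayley coordinate on the unitary group of `W = range p`. For `g` unitary on `W` with
`1 + g` invertible it is `(g - p) (g + p)⁻¹`, since `(g + p)* (g - p) = g - g*`; we write it as
`c* (g - g*) c` with `c = (g + p)⁻¹` (inverse in the operators on `W`), which is visibly
skew-adjoint. -/
def cayleyCoord (p : Proj H) (g : H →L[ℂ] H) : H →L[ℂ] H :=
  star (p.1 * Ring.inverse (1 + g) * p.1) * (g - star g) * (p.1 * Ring.inverse (1 + g) * p.1)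

theorem cayleyCoord_mem (p : Proj H) (g : H →L[ℂ] H) : cayleyCoord p g ∈ skewCorner p := by
  have h2 := p.mul_self
  have h3 := p.star_eq
  refine ⟨?_, ?_⟩
  · unfold cayleyCoord
    simp only [star_mul, star_sub, star_star, h3]
    noncomm_ring
  · unfold cayleyCoord
    simp only [star_mul, h3, mul_assoc, h2]
    simp only [← mul_assoc, h2]

/-- The domain of the chart of the set of partial isometries at `u₀`. -/
def partialIsometryDomain (u₀ : PIso H) : Set (PIso H) :=
  {v | v.tgt ∈ graphDomain u₀.tgt ∧ v.src ∈ graphDomain u₀.src ∧ IsUnit (1 + unitaryPart u₀ v)}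

/-- The chart of the set of partial isometries at `u₀`: the graph coordinates of the final and
of the initial space, and the Cayley coordinate of the unitary part. -/
def partialIsometryChart (u₀ : PIso H) : BanachChart (PIso H) where
  model := offDiag u₀.tgt × offDiag u₀.src × skewCorner u₀.src
  source := partialIsometryDomain u₀
  toFun v := (⟨graphCoord u₀.tgt v.tgt, graphCoord_mem _ _⟩,
    ⟨graphCoord u₀.src v.src, graphCoord_mem _ _⟩,
    ⟨cayleyCoord u₀.src (unitaryPart u₀ v), cayleyCoord_mem _ _⟩)

variable (H) in
/-- The atlas of the set of all partial isometries of `H`. -/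
def partialIsometryAtlas : PIso H → BanachChart (PIso H) := partialIsometryChart

/-! ### The restricted Grassmannian and its groupoid, for the ideal of compact operators -/

section Restricted

variable (Hp : Submodule ℂ H) [Hp.HasOrthogonalProjection]

/-- The restricted Grassmannian with respect to the polarization `H = Hp ⊕ Hpᗮ` and the ideal of
compact operators: closed subspaces `W` (ranges of projections) such that the orthogonal projection
`W → Hp` is Fredholm and the orthogonal projection `W → Hpᗮ` is compact. -/
def resGrassmannian : Set (Proj H) :=
  {p | (Hp.orthogonalProjectionOnto ∘L
          (LinearMap.range (p.1 : H →ₗ[ℂ] H)).subtypeL).IsFredholm ∧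
       IsCompactOperator (Hpᗮ.orthogonalProjectionOnto ∘L
          (LinearMap.range (p.1 : H →ₗ[ℂ] H)).subtypeL)}

variable {Hp}

theorem isCompactOperator_of_hasNoetherianRange {E F : Type u} [NormedAddCommGroup E]
    [NormedSpace ℂ E] [NormedAddCommGroup F] [NormedSpace ℂ F] (f : E →L[ℂ] F)
    (hf : (f : E →ₗ[ℂ] F).HasNoetherianRange) : IsCompactOperator f := by
  have hfin : FiniteDimensional ℂ (LinearMap.range (f : E →ₗ[ℂ] F)) :=
    haveI := hf.isNoetherian_range
    inferInstance
  have : ProperSpace (LinearMap.range (f : E →ₗ[ℂ] F)) := FiniteDimensional.proper ℂ _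
  have h : IsCompactOperator (f.codRestrict (LinearMap.range (f : E →ₗ[ℂ] F))
      (fun x => LinearMap.mem_range_self _ x)) :=
    (isCompactOperator_id (E := LinearMap.range (f : E →ₗ[ℂ] F))).comp_clm
      (f.codRestrict (LinearMap.range (f : E →ₗ[ℂ] F)) (fun x => LinearMap.mem_range_self _ x))
  exact h.clm_comp (LinearMap.range (f : E →ₗ[ℂ] F)).subtypeL

theorem isCompactOperator_one_sub_comp_subtypeL {p : Proj H} (hp : p ∈ resGrassmannian Hp) :
    IsCompactOperator ((1 - p.1) ∘L Hp.subtypeL) := by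
  let W := LinearMap.range (p.1 : H →ₗ[ℂ] H)
  let T : W →L[ℂ] Hp := Hp.orthogonalProjectionOnto ∘L W.subtypeL
  have hT : T.IsFredholm := hp.1
  obtain ⟨S, hS⟩ := hT.exists_isQuasiInverse
  have hF : IsCompactOperator (T ∘L S - ContinuousLinearMap.id ℂ Hp) :=
    isCompactOperator_of_hasNoetherianRange _ (LinearMap.FiniteRangeSetoid.equiv_iff_hasNoetherianRange.1 hS.2)
  have h1 := ((hp.2.clm_comp Hpᗮ.subtypeL).clm_comp (1 - p.1)).comp_clm S
  have h2 := hF.clm_comp ((1 - p.1) ∘L Hp.subtypeL)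
  refine (congrArg IsCompactOperator (funext fun x => ?_)).mpr (h1.add h2).neg
  have hw : (1 - p.1) ((S x : W) : H) = 0 := by
    obtain ⟨y, hy⟩ := (S x).2
    have hy' : p.1 y = (S x : H) := hy
    rw [← hy']
    change ((1 - p.1) * p.1) y = 0
    rw [p.2.one_sub_mul_self]; rfl
  have hsum : ((S x : W) : H) = (T (S x) : H) +
      (Hpᗮ.orthogonalProjectionOnto ((S x : W) : H) : H) :=
    (Hp.starProjection_add_starProjection_orthogonal _).symm
  rw [hsum, map_add] at hw
  have hval : (((T ∘L S - ContinuousLinearMap.id ℂ Hp) x : Hp) : H) = (T (S x) : H) - x := rfl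
  change (1 - p.1) (x : H) = -((1 - p.1) (Hpᗮ.orthogonalProjectionOnto ((S x : W) : H) : H) +
    (1 - p.1) (((T ∘L S - ContinuousLinearMap.id ℂ Hp) x : Hp) : H))
  rw [hval, map_sub, ← sub_eq_zero, ← hw]
  abel

/-- If the ranges of `p` and `q` are in the restricted Grassmannian, then `(1 - p) q` is compact. -/
theorem isCompactOperator_one_sub_mul {p q : Proj H} (hp : p ∈ resGrassmannian Hp)
    (hq : q ∈ resGrassmannian Hp) :
    IsCompactOperator ((1 - p.1) * q.1 : H →L[ℂ] H) := by
  have h1 := (isCompactOperator_one_sub_comp_subtypeL hp).comp_clm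
    (Hp.orthogonalProjectionOnto ∘L q.1)
  have h2 := ((hq.2.clm_comp Hpᗮ.subtypeL).clm_comp (1 - p.1)).comp_clm
    ((q.1).codRestrict (LinearMap.range (q.1 : H →ₗ[ℂ] H)) (fun x => LinearMap.mem_range_self _ x))
  refine (congrArg IsCompactOperator (funext fun x => ?_)).mpr (h1.add h2)
  have hsum : q.1 x = (Hp.orthogonalProjectionOnto (q.1 x) : H) +
      (Hpᗮ.orthogonalProjectionOnto (q.1 x) : H) :=
    (Hp.starProjection_add_starProjection_orthogonal _).symm
  change (1 - p.1) (q.1 x) = (1 - p.1) (Hp.orthogonalProjectionOnto (q.1 x) : H) +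
    (1 - p.1) (Hpᗮ.orthogonalProjectionOnto (q.1 x) : H)
  rw [← map_add, ← hsum]

theorem graphCoord_mem_compactOffDiag {p q : Proj H} (hp : p ∈ resGrassmannian Hp)
    (hq : q ∈ resGrassmannian Hp) : graphCoord p q ∈ compactOffDiag p := by
  refine ⟨graphCoord_mem p q, ?_⟩
  have h := (isCompactOperator_one_sub_mul hp hq).comp_clm
    (p.1 * Ring.inverse (p.1 * q.1 * p.1 + (1 - p.1)) * p.1)
  have e : graphCoord p q = ((1 - p.1) * q.1) *
    (p.1 * Ring.inverse (p.1 * q.1 * p.1 + (1 - p.1)) * p.1) := by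
    unfold graphCoord; simp only [mul_assoc]
  rw [e]
  exact h

variable (Hp)

/-- The graph charts of the restricted Grassmannian, with values in compact operators. -/
def resGrassmannianAtlas :
    {p // p ∈ resGrassmannian Hp} → BanachChart {p // p ∈ resGrassmannian Hp} := fun p =>
  { model := compactOffDiag p.1
    source := {q | q.1 ∈ graphDomain p.1}
    toFun := fun q => ⟨graphCoord p.1 q.1, graphCoord_mem_compactOffDiag p.2 q.2⟩ }

/-- The set of partial isometries with initial and final space in the restricted Grassmannian. -/
abbrev ResPIso : Type u :=
  {v : PIso H // (partialIsometryGroupoid H).s v ∈ resGrassmannian Hp ∧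
    (partialIsometryGroupoid H).t v ∈ resGrassmannian Hp}

/-- The groupoid of partial isometries over the restricted Grassmannian. -/
def resPartialIsometryGroupoid :
    SetGroupoid (ResPIso Hp) {p // p ∈ resGrassmannian Hp} :=
  (partialIsometryGroupoid H).restrict (resGrassmannian Hp)

/-- The charts of the set of partial isometries over the restricted Grassmannian: the graph
coordinates are taken in compact operators, the unitary part is arbitrary. -/
def resPartialIsometryAtlas : ResPIso Hp → BanachChart (ResPIso Hp) := fun u₀ =>
  { model := compactOffDiag u₀.1.tgt × compactOffDiag u₀.1.src × skewCorner u₀.1.src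
    source := {v | v.1 ∈ partialIsometryDomain u₀.1}
    toFun := fun v =>
      (⟨graphCoord u₀.1.tgt v.1.tgt, graphCoord_mem_compactOffDiag u₀.2.2 v.2.2⟩,
        ⟨graphCoord u₀.1.src v.1.src, graphCoord_mem_compactOffDiag u₀.2.1 v.2.1⟩,
        ⟨cayleyCoord u₀.1.src (unitaryPart u₀.1 v.1), cayleyCoord_mem _ _⟩) }

end Restricted

end Hilbert

end

/-!
Each chart is the restriction of a smooth map on an open set of bounded operators, and its inverse
is smooth as a map into the bounded operators; the only irrational ingredient, the square root in
the cross-sections, is given by a binomial series. So the smoothness of transition maps, structure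
maps and inclusions reduces to that of formulas in operators. For the restricted groupoid these
formulas take values in compact operators, and a map into a closed subspace is smooth as soon as it
is smooth into the ambient space, whether or not the subspace is complemented. Source, target and
both inclusions are linear in suitable charts: the former are coordinate projections, the latter
extend the inclusion of `L⁰(W, Wᗮ)` into `L^∞(W, Wᗮ)`. That inclusion has no bounded left inverse:
restricted to diagonal operators, such an inverse would project `ℓ^∞` onto `c₀`, and Whitley's
argument with an uncountable almost disjoint family of sets of integers excludes it.
-/

noncomputable section

/-! ### Smooth maps into closed subspaces -/

section ClosedSubspace

theorem hasFDerivAt_apply_mem_of_isClosed {X G : Type*} [NormedAddCommGroup X] [NormedSpace ℝ X]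
    [NormedAddCommGroup G] [NormedSpace ℝ G] {K : Submodule ℝ G} (hK : IsClosed (K : Set G))
    {f : X → G} (hf : ∀ y, f y ∈ K) {x : X} {D : X →L[ℝ] G} (h : HasFDerivAt f D x) (v : X) :
    D v ∈ K := by
  have hslope := hasDerivAt_iff_tendsto_slope.1 (h.hasLineDerivAt v)
  refine hK.mem_of_tendsto hslope (Filter.Eventually.of_forall fun t => ?_)
  rw [slope_def_module]
  exact K.smul_mem _ (K.sub_mem (hf _) (hf _))

theorem exists_hasFDerivAt_of_linearIsometry_comp {X F G : Type*}
    [NormedAddCommGroup X] [NormedSpace ℝ X] [NormedAddCommGroup F] [NormedSpace ℝ F]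
    [CompleteSpace F] [NormedAddCommGroup G] [NormedSpace ℝ G] (ι : F →ₗᵢ[ℝ] G)
    {g : X → F} {x : X} {D : X →L[ℝ] G} (h : HasFDerivAt (fun y => ι (g y)) D x) :
    ∃ D' : X →L[ℝ] F, ι.toContinuousLinearMap ∘L D' = D ∧ HasFDerivAt g D' x := by
  have hmem : ∀ v, D v ∈ LinearMap.range ι.toLinearMap :=
    hasFDerivAt_apply_mem_of_isClosed (K := LinearMap.range ι.toLinearMap)
      ι.isometry.isClosedEmbedding.isClosed_range (fun y => ⟨g y, rfl⟩) h
  let D' : X →L[ℝ] F := ι.equivRange.symm.toContinuousLinearEquiv.toContinuousLinearMap ∘L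
    D.codRestrict (LinearMap.range ι.toLinearMap) hmem
  have hD' : ι.toContinuousLinearMap ∘L D' = D := ContinuousLinearMap.ext fun v =>
    congrArg Subtype.val (ι.equivRange.apply_symm_apply ⟨D v, hmem v⟩)
  refine ⟨D', hD', HasFDerivAt.of_comp_of_isEmbedding
    (ι.isometry.isEmbedding.continuousAt_iff.2 h.continuousAt)
    ι.toContinuousLinearMap.hasFDerivAt ι.isometry.isEmbedding ?_ Filter.EventuallyEq.rfl⟩
  rwa [hD']

variable {X : Type u} [NormedAddCommGroup X] [NormedSpace ℝ X] {s : Set X}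

theorem contDiffOn_nat_of_linearIsometry_comp (hs : IsOpen s) (n : ℕ) :
    ∀ {F G : Type u} [NormedAddCommGroup F] [NormedSpace ℝ F] [CompleteSpace F]
      [NormedAddCommGroup G] [NormedSpace ℝ G] (ι : F →ₗᵢ[ℝ] G) {g : X → F},
      ContDiffOn ℝ n (fun y => ι (g y)) s → ContDiffOn ℝ n g s := by
  induction n with
  | zero =>
    intro F G _ _ _ _ _ ι g h
    simp only [Nat.cast_zero, contDiffOn_zero] at h ⊢
    exact ι.isometry.isEmbedding.continuousOn_iff.2 h
  | succ n ih =>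
    intro F G _ _ _ _ _ ι g h
    rw [Nat.cast_succ, contDiffOn_succ_iff_fderiv_of_isOpen hs] at h ⊢
    have hderiv : ∀ x ∈ s, DifferentiableAt ℝ g x ∧
        ι.toContinuousLinearMap ∘L fderiv ℝ g x = fderiv ℝ (fun y => ι (g y)) x := by
      intro x hx
      obtain ⟨D', hD', hg⟩ := exists_hasFDerivAt_of_linearIsometry_comp ι
        ((h.1 x hx).differentiableAt (hs.mem_nhds hx)).hasFDerivAt
      exact ⟨hg.differentiableAt, by rw [hg.fderiv, hD']⟩
    let postcomp : (X →L[ℝ] F) →ₗᵢ[ℝ] (X →L[ℝ] G) :=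
      { toLinearMap := (ContinuousLinearMap.compL ℝ X F G ι.toContinuousLinearMap).toLinearMap
        norm_map' := fun _ => ι.norm_toContinuousLinearMap_comp }
    exact ⟨fun x hx => (hderiv x hx).1.differentiableWithinAt, by simp,
      ih postcomp (h.2.2.congr fun x hx => (hderiv x hx).2)⟩

theorem contDiffOn_infty_of_linearIsometry_comp {F G : Type u} [NormedAddCommGroup F]
    [NormedSpace ℝ F] [CompleteSpace F] [NormedAddCommGroup G] [NormedSpace ℝ G]
    (ι : F →ₗᵢ[ℝ] G) (hs : IsOpen s) {g : X → F} (h : ContDiffOn ℝ ∞ (fun y => ι (g y)) s) :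
    ContDiffOn ℝ ∞ g s := by
  rw [contDiffOn_infty] at h ⊢
  exact fun n => contDiffOn_nat_of_linearIsometry_comp hs n ι (h n)

end ClosedSubspace

/-! ### Atlases of subsets of a normed space -/

section Slice

variable {M N : Type u} {E E' : Type u} [NormedAddCommGroup E] [NormedSpace ℝ E]
  [NormedAddCommGroup E'] [NormedSpace ℝ E']

/-- A chart `φ` of `M` adapted to an injective map `e : M → E`: it is onto its model space, it is
the restriction of a smooth map on an open subset of `E` with values in a space containing the
model space, and its inverse is smooth as a map into `E`. The model space need not be complemented
in the larger one, so that the image of `e` need not be a submanifold of `E`. -/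
structure SliceChart (e : M → E) (φ : BanachChart M) where
  /-- a normed space that contains the model space of the chart -/
  ambient : Type u
  [normedAddCommGroup : NormedAddCommGroup ambient]
  [normedSpace : NormedSpace ℝ ambient]
  /-- the embedding of the model space -/
  ι : φ.model →ₗᵢ[ℝ] ambient
  /-- the domain of the extended chart -/
  U : Set E
  /-- the extended chart -/
  Φ : E → ambient
  /-- the inverse of the chart -/
  Ψ : φ.model → E
  injective : Function.Injective e
  isOpen_U : IsOpen U
  contDiffOn_Φ : ContDiffOn ℝ ∞ Φ U
  contDiff_Ψ : ContDiff ℝ ∞ Ψ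
  mem_source : ∀ x, x ∈ φ.source ↔ e x ∈ U
  Φ_apply : ∀ x ∈ φ.source, Φ (e x) = ι (φ.toFun x)
  Ψ_toFun : ∀ x ∈ φ.source, Ψ (φ.toFun x) = e x
  surj : ∀ y, ∃ x ∈ φ.source, φ.toFun x = y

attribute [instance] SliceChart.normedAddCommGroup SliceChart.normedSpace

/-- The map `f : M → N` is the restriction of a smooth map between the normed spaces in which `e`
and `e'` place `M` and `N`. -/
def ExtendsSmoothly (e : M → E) (e' : N → E') (f : M → N) : Prop :=
  ∃ F : E → E', ContDiff ℝ ∞ F ∧ ∀ x, e' (f x) = F (e x)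

theorem ExtendsSmoothly.id (e : M → E) : ExtendsSmoothly e e id :=
  ⟨_root_.id, contDiff_id, fun _ => rfl⟩

/-- In the charts `φ` and `ψ`, the map `f` is the continuous linear map `L`. -/
structure IsLinearInCharts (φ : BanachChart M) (ψ : BanachChart N) (f : M → N)
    (L : φ.model →L[ℝ] ψ.model) : Prop where
  mapsTo : Set.MapsTo f φ.source ψ.source
  toFun_apply : ∀ x ∈ φ.source, ψ.toFun (f x) = L (φ.toFun x)

namespace SliceChart

variable {P : Type u} {E'' : Type u} [NormedAddCommGroup E''] [NormedSpace ℝ E'']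
  {e : M → E} {e' : N → E'} {e'' : P → E''}
  {φ φ' : BanachChart M} {ψ ψ' : BanachChart N} {χ : BanachChart P} {f : M → N} {g : N → P}

theorem injOn (S : SliceChart e φ) : Set.InjOn φ.toFun φ.source :=
  fun x hx y hy h => S.injective (by rw [← S.Ψ_toFun x hx, h, S.Ψ_toFun y hy])

theorem localRep_toFun (S : SliceChart e φ) (ψ : BanachChart N) (f : M → N) {x : M}
    (hx : x ∈ φ.source) : localRep φ ψ f (φ.toFun x) = ψ.toFun (f x) := by
  have hinj : Function.Injective fun x : φ.source => φ.toFun x :=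
    fun a b h => Subtype.ext (S.injOn a.2 b.2 h)
  exact hinj.extend_apply (fun x : φ.source => ψ.toFun (f x)) 0 ⟨x, hx⟩

theorem localDomain_eq (S : SliceChart e φ) (T : SliceChart e' ψ) {F : E → E'}
    (hF : ∀ x, e' (f x) = F (e x)) : localDomain φ ψ f = {y | F (S.Ψ y) ∈ T.U} := by
  ext y
  obtain ⟨x, hx, rfl⟩ := S.surj y
  rw [Set.mem_ofPred_eq, S.Ψ_toFun x hx, ← hF, ← T.mem_source]
  refine ⟨?_, fun hfx => ⟨x, ⟨hx, hfx⟩, rfl⟩⟩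
  rintro ⟨x', ⟨hx', hfx'⟩, h⟩
  rwa [← S.injOn hx' hx h]

theorem isOpen_localDomain (S : SliceChart e φ) (T : SliceChart e' ψ)
    (hf : ExtendsSmoothly e e' f) : IsOpen (localDomain φ ψ f) := by
  obtain ⟨F, hs, hF⟩ := hf
  rw [S.localDomain_eq T hF]
  exact T.isOpen_U.preimage (hs.continuous.comp S.contDiff_Ψ.continuous)

theorem contDiffOn_localRep (S : SliceChart e φ) (T : SliceChart e' ψ)
    (hf : ExtendsSmoothly e e' f) :
    ContDiffOn ℝ ∞ (localRep φ ψ f) (localDomain φ ψ f) := by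
  refine contDiffOn_infty_of_linearIsometry_comp T.ι (S.isOpen_localDomain T hf) ?_
  obtain ⟨F, hs, hF⟩ := hf
  have hmaps : Set.MapsTo (fun y => F (S.Ψ y)) (localDomain φ ψ f) T.U :=
    (S.localDomain_eq T hF).le
  refine (T.contDiffOn_Φ.comp (hs.comp S.contDiff_Ψ).contDiffOn hmaps).congr ?_
  rintro _ ⟨x, ⟨hx, hfx⟩, rfl⟩
  simp only [Function.comp_apply]
  rw [S.localRep_toFun ψ f hx, S.Ψ_toFun x hx, ← hF, T.Φ_apply _ hfx]

theorem differentiableAt_localRep (S : SliceChart e φ) (T : SliceChart e' ψ)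
    (hf : ExtendsSmoothly e e' f) {x : M} (hx : x ∈ φ.source) (hfx : f x ∈ ψ.source) :
    DifferentiableAt ℝ (localRep φ ψ f) (φ.toFun x) :=
  ((S.contDiffOn_localRep T hf).differentiableOn (by simp)).differentiableAt
    ((S.isOpen_localDomain T hf).mem_nhds ⟨x, ⟨hx, hfx⟩, rfl⟩)

theorem tangentRep_comp (S : SliceChart e φ) (T : SliceChart e' ψ) (R : SliceChart e'' χ)
    (hf : ExtendsSmoothly e e' f) (hg : ExtendsSmoothly e' e'' g) {x : M}
    (hx : x ∈ φ.source) (hfx : f x ∈ ψ.source) (hgx : g (f x) ∈ χ.source) :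
    tangentRep φ χ (g ∘ f) x = tangentRep ψ χ g (f x) ∘L tangentRep φ ψ f x := by
  have hcomp : localRep φ χ (g ∘ f) =ᶠ[nhds (φ.toFun x)] localRep ψ χ g ∘ localRep φ ψ f := by
    filter_upwards [(S.isOpen_localDomain T hf).mem_nhds ⟨x, ⟨hx, hfx⟩, rfl⟩]
    rintro _ ⟨x', ⟨hx', hfx'⟩, rfl⟩
    rw [Function.comp_apply, S.localRep_toFun χ _ hx', S.localRep_toFun ψ _ hx',
      T.localRep_toFun χ _ hfx', Function.comp_apply]
  have hdg := T.differentiableAt_localRep R hg hfx hgx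
  rw [tangentRep, hcomp.fderiv_eq, fderiv_comp _ (by rwa [S.localRep_toFun ψ f hx])
    (S.differentiableAt_localRep T hf hx hfx), S.localRep_toFun ψ f hx]
  rfl

theorem tangentRep_eq_of_isLinearInCharts (S : SliceChart e φ) {L : φ.model →L[ℝ] ψ.model}
    (hL : IsLinearInCharts φ ψ f L) {x : M} : tangentRep φ ψ f x = L := by
  have : localRep φ ψ f = L := by
    funext y
    obtain ⟨x, hx, rfl⟩ := S.surj y
    rw [S.localRep_toFun ψ f hx, hL.toFun_apply x hx]
  rw [tangentRep, this, L.fderiv]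

theorem isInvertible_tangentRep_id (S : SliceChart e φ) (S' : SliceChart e φ') {x : M}
    (hx : x ∈ φ.source) (hx' : x ∈ φ'.source) : (tangentRep φ φ' id x).IsInvertible := by
  have hid := ExtendsSmoothly.id e
  have hself : ∀ {φ : BanachChart M}, SliceChart e φ →
      tangentRep φ φ id x = ContinuousLinearMap.id ℝ φ.model :=
    fun S => S.tangentRep_eq_of_isLinearInCharts ⟨fun _ h => h, fun _ _ => rfl⟩
  exact ContinuousLinearMap.IsInvertible.of_inverse
    ((S'.tangentRep_comp S S' hid hid hx' hx hx').symm.trans (hself S'))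
    ((S.tangentRep_comp S' S hid hid hx hx' hx).symm.trans (hself S))

theorem exists_tangentRep_eq_comp (S : SliceChart e φ) (T : SliceChart e' ψ)
    (T' : SliceChart e' ψ') (hf : ExtendsSmoothly e e' f) {L : φ.model →L[ℝ] ψ.model}
    (hL : IsLinearInCharts φ ψ f L) {x : M} (hx : x ∈ φ.source) (hx' : f x ∈ ψ'.source) :
    ∃ D : ψ.model ≃L[ℝ] ψ'.model,
      tangentRep φ ψ' f x = (D : ψ.model →L[ℝ] ψ'.model) ∘L L := by
  obtain ⟨D, hD⟩ := T.isInvertible_tangentRep_id T' (hL.mapsTo hx) hx'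
  refine ⟨D, ?_⟩
  rw [hD, ← S.tangentRep_eq_of_isLinearInCharts hL (x := x)]
  exact S.tangentRep_comp T T' hf (ExtendsSmoothly.id e') hx (hL.mapsTo hx) hx'

end SliceChart

variable {ι κ : Type u} {e : M → E} {e' : N → E'} {A : ι → BanachChart M} {B : κ → BanachChart N}
  {f : M → N}

/-- An atlas all of whose charts are adapted to the same map `e` into a normed space. The manifold
then has the topology induced by `e`. -/
structure SliceAtlas (e : M → E) (A : ι → BanachChart M) where
  /-- the extensions of the charts -/
  chart : ∀ i, SliceChart e (A i)
  covers : ∀ x, ∃ i, x ∈ (A i).source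

namespace SliceAtlas

theorem injective (S : SliceAtlas e A) : Function.Injective e := fun x _ h =>
  (S.covers x).elim fun i _ => (S.chart i).injective h

theorem atlasTopology_eq_induced (S : SliceAtlas e A) :
    atlasTopology A = TopologicalSpace.induced e inferInstance := by
  apply le_antisymm
  · rintro _ ⟨O, hO, rfl⟩
    have hcover : e ⁻¹' O =
        ⋃ i, (A i).source ∩ (A i).toFun ⁻¹' ((S.chart i).Ψ ⁻¹' O) := by
      ext x
      simp only [Set.mem_preimage, Set.mem_iUnion, Set.mem_inter_iff]
      constructor
      · intro hx
        obtain ⟨i, hi⟩ := S.covers x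
        exact ⟨i, hi, by rwa [(S.chart i).Ψ_toFun x hi]⟩
      · rintro ⟨i, hi, hx⟩
        rwa [(S.chart i).Ψ_toFun x hi] at hx
    rw [hcover]
    exact @isOpen_iUnion _ _ (atlasTopology A) _ fun i =>
      TopologicalSpace.isOpen_generateFrom_of_mem
        ⟨i, _, hO.preimage (S.chart i).contDiff_Ψ.continuous, rfl⟩
  · refine le_generateFrom ?_
    rintro _ ⟨i, O, hO, rfl⟩
    obtain ⟨O', hO', rfl⟩ := (S.chart i).ι.isometry.isEmbedding.isInducing.isOpen_iff.1 hO
    refine ⟨(S.chart i).U ∩ (S.chart i).Φ ⁻¹' O',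
      (S.chart i).contDiffOn_Φ.continuousOn.isOpen_inter_preimage (S.chart i).isOpen_U hO', ?_⟩
    ext x
    simp only [Set.mem_preimage, Set.mem_inter_iff, ← (S.chart i).mem_source]
    exact and_congr_right fun hx => by rw [(S.chart i).Φ_apply x hx]

theorem isBanachManifold (S : SliceAtlas e A) : IsBanachManifold A where
  covers := S.covers
  injOn i := (S.chart i).injOn
  isOpen_overlap i j := (S.chart i).isOpen_localDomain (S.chart j) (.id e)
  contDiffOn_transition i j := (S.chart i).contDiffOn_localRep (S.chart j) (.id e)
  t2 := by
    rw [S.atlasTopology_eq_induced]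
    let := TopologicalSpace.induced e inferInstance
    exact T2Space.of_injective_continuous S.injective continuous_induced_dom

theorem isSmoothMap (S : SliceAtlas e A) (T : SliceAtlas e' B) (hf : ExtendsSmoothly e e' f) :
    IsSmoothMap A B f := fun i j =>
  ⟨(S.chart i).isOpen_localDomain (T.chart j) hf, (S.chart i).contDiffOn_localRep (T.chart j) hf⟩

theorem isEmbedding_of_comp_eq {e' : N → E} (S : SliceAtlas e A) (T : SliceAtlas e' B)
    {f : N → M} (hf : e ∘ f = e') :
    @Topology.IsEmbedding N M (atlasTopology B) (atlasTopology A) f := by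
  rw [S.atlasTopology_eq_induced, T.atlasTopology_eq_induced]
  let : TopologicalSpace M := TopologicalSpace.induced e inferInstance
  let : TopologicalSpace N := TopologicalSpace.induced e' inferInstance
  refine ⟨⟨?_⟩, Function.Injective.of_comp (f := e) (hf ▸ T.injective)⟩
  rw [induced_compose, hf]

theorem isSubmersion (S : SliceAtlas e A) (T : SliceAtlas e' B) (hf : ExtendsSmoothly e e' f)
    (hlin : ∀ i, ∃ j, ∃ L : (A i).model →L[ℝ] (B j).model,
      L.HasRightInverse ∧ IsLinearInCharts (A i) (B j) f L) :
    IsSubmersion A B f := by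
  refine ⟨S.isSmoothMap T hf, fun x i k hx hfx => ?_⟩
  obtain ⟨j, L, hright, hL⟩ := hlin i
  obtain ⟨D, hD⟩ :=
    (S.chart i).exists_tangentRep_eq_comp (T.chart j) (T.chart k) hf hL hx hfx
  have hDL : (tangentRep (A i) (B k) f x).HasRightInverse := hD ▸ D.hasRightInverse.comp hright
  exact ⟨hDL.surjective, ContinuousLinearMap.closedComplemented_ker_of_rightInverse _ _
    hDL.rightInverse_rightInverse⟩

theorem isImmersedSubmanifold (S : SliceAtlas e A) (T : SliceAtlas e' B)
    (hinj : Function.Injective f) (hf : ExtendsSmoothly e e' f)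
    (hlin : ∀ i, ∃ j, ∃ L : (A i).model →ₗᵢ[ℝ] (B j).model,
      IsLinearInCharts (A i) (B j) f L.toContinuousLinearMap) :
    IsImmersedSubmanifold A B f := by
  refine ⟨hinj, S.isSmoothMap T hf, fun x i k hx hfx => ?_⟩
  obtain ⟨j, L, hL⟩ := hlin i
  obtain ⟨D, hD⟩ :=
    (S.chart i).exists_tangentRep_eq_comp (T.chart j) (T.chart k) hf hL hx hfx
  have hcomp : ⇑(tangentRep (A i) (B k) f x) = D ∘ L := by rw [hD]; rfl
  rw [hcomp]
  exact ⟨D.injective.comp L.injective,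
    (D.toHomeomorph.isClosedEmbedding.comp L.isometry.isClosedEmbedding).isClosed_range⟩

theorem hasLeftInverse_of_isSplitImmersedSubmanifold (S : SliceAtlas e A)
    {i : ι} {j : κ} {L : (A i).model →L[ℝ] (B j).model} (hL : IsLinearInCharts (A i) (B j) f L)
    (h : IsSplitImmersedSubmanifold A B f) : L.HasLeftInverse := by
  obtain ⟨x, hx, -⟩ := (S.chart i).surj 0
  have himm := h.1.2.2 x i j hx (hL.mapsTo hx)
  have hsplit := h.2 x i j hx (hL.mapsTo hx)
  rw [(S.chart i).tangentRep_eq_of_isLinearInCharts hL] at himm hsplit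
  exact .of_injective_of_isClosed_range_of_closedComplement_range himm.1 himm.2 hsplit

end SliceAtlas

end Slice

/-- The multiplication need only preserve the model spaces: the product of two arrows has
coordinates in the model space even if the arrows are not composable. -/
theorem SliceAtlas.isSmoothMul {G M ι E : Type u} [NormedRing E] [NormedAlgebra ℝ E]
    {e : G → E} {A : ι → BanachChart G} (S : SliceAtlas e A) (𝒢 : SetGroupoid G M)
    (hmul : ∀ g h (c : 𝒢.s g = 𝒢.t h), e (𝒢.mul g h c) = e g * e h)
    (hrange : ∀ g h k, e g * e h ∈ (S.chart k).U →
      (S.chart k).Φ (e g * e h) ∈ Set.range (S.chart k).ι) :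
    𝒢.IsSmoothMul A := by
  intro g h c i j k hg hh hk
  let m : (A i).model × (A j).model → E := fun z => (S.chart i).Ψ z.1 * (S.chart j).Ψ z.2
  have hm : ContDiff ℝ ∞ m :=
    ((S.chart i).contDiff_Ψ.comp contDiff_fst).mul ((S.chart j).contDiff_Ψ.comp contDiff_snd)
  have hm_coord : ∀ g' ∈ (A i).source, ∀ h' ∈ (A j).source,
      m ((A i).toFun g', (A j).toFun h') = e g' * e h' := fun g' hg' h' hh' => by
    simp only [m, (S.chart i).Ψ_toFun g' hg', (S.chart j).Ψ_toFun h' hh']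
  have hO : IsOpen (m ⁻¹' (S.chart k).U) := (S.chart k).isOpen_U.preimage hm.continuous
  have hlift : ∀ z ∈ m ⁻¹' (S.chart k).U, ∃ y, (S.chart k).ι y = (S.chart k).Φ (m z) := by
    intro z hz
    obtain ⟨g', hg', hz₁⟩ := (S.chart i).surj z.1
    obtain ⟨h', hh', hz₂⟩ := (S.chart j).surj z.2
    obtain rfl : ((A i).toFun g', (A j).toFun h') = z := Prod.ext hz₁ hz₂
    rw [Set.mem_preimage, hm_coord g' hg' h' hh'] at hz
    rw [hm_coord g' hg' h' hh']
    exact hrange g' h' k hz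
  choose! F hF using hlift
  refine ⟨m ⁻¹' (S.chart k).U, F, hO, ?_, ?_, fun g' h' c' hg' hh' hz => ?_⟩
  · rw [Set.mem_preimage, hm_coord g hg h hh, ← hmul g h c]
    exact ((S.chart k).mem_source _).1 hk
  · refine contDiffOn_infty_of_linearIsometry_comp (S.chart k).ι hO ?_
    exact ((S.chart k).contDiffOn_Φ.comp hm.contDiffOn fun _ hz => hz).congr hF
  · have hFz := hF _ hz
    rw [Set.mem_preimage, hm_coord g' hg' h' hh', ← hmul g' h' c'] at hz
    have hsource := ((S.chart k).mem_source _).2 hz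
    refine ⟨hsource, (S.chart k).ι.injective ?_⟩
    rw [hFz, hm_coord g' hg' h' hh', ← hmul g' h' c', (S.chart k).Φ_apply _ hsource]

/-! ### Smoothness of the square root near the identity of a C*-algebra -/

theorem hasFPowerSeriesOnBall_binomialSeries (A : Type*) [NormedRing A] [NormedAlgebra ℝ A]
    [NormOneClass A] [CompleteSpace A] (a : ℝ) :
    HasFPowerSeriesOnBall (binomialSeries A a).sum (binomialSeries A a) 0 1 := by
  have hradius : 1 ≤ (binomialSeries A a).radius := by
    have h : (binomialSeries A a).radius = (binomialSeries ℝ a).radius := by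
      simp only [FormalMultilinearSeries.radius, binomialSeries,
        FormalMultilinearSeries.ofScalars_norm]
    exact h ▸ binomialSeries_radius_ge_one
  exact ((binomialSeries A a).hasFPowerSeriesOnBall (one_pos.trans_le hradius)).mono one_pos hradius

section CStarAlgebra

variable {A : Type*} [CStarAlgebra A]

theorem cfc_partialSum_binomialSeries (a : ℝ) (n : ℕ) {x : A} (hx : IsSelfAdjoint x) :
    cfc (fun y : ℝ => (binomialSeries ℝ a).partialSum n y) x =
      (binomialSeries A a).partialSum n x := by
  simp only [FormalMultilinearSeries.partialSum, binomialSeries_apply, List.ofFn_const,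
    List.prod_replicate]
  have hsum := cfc_sum (fun (k : ℕ) (y : ℝ) => Ring.choose a k • y ^ k) x (Finset.range n)
    (fun k _ => by fun_prop)
  rw [Finset.sum_fn] at hsum
  rw [hsum]
  refine Finset.sum_congr rfl fun k _ => ?_
  rw [cfc_smul _ _ _ (by fun_prop), cfc_pow_id x k]

theorem cfc_one_add_rpow_eq_sum_binomialSeries [NormOneClass A] (a : ℝ) {x : A}
    (hx : IsSelfAdjoint x) (hx1 : ‖x‖ < 1) :
    cfc (fun y : ℝ => (1 + y) ^ a) x = (binomialSeries A a).sum x := by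
  obtain ⟨r, hxr, hr1⟩ := exists_between hx1
  have hr0 : 0 ≤ r := (norm_nonneg x).trans hxr.le
  have hunif : TendstoUniformlyOn (fun n (y : ℝ) => (binomialSeries ℝ a).partialSum n y)
      (fun y : ℝ => (1 + y) ^ a) Filter.atTop (spectrum ℝ x) := by
    have h := (Real.one_add_rpow_hasFPowerSeriesOnBall_zero (a := a)).tendstoUniformlyOn
      (r' := r.toNNReal) (by
        rw [← ENNReal.coe_one, ENNReal.coe_lt_coe]
        exact Real.toNNReal_lt_one.2 hr1)
    simp only [zero_add] at h
    refine h.mono fun y hy => ?_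
    rw [Real.coe_toNNReal r hr0, mem_ball_zero_iff]
    exact (spectrum.norm_le_norm_of_mem hy).trans_lt hxr
  have hcfc := tendsto_cfc_fun (a := x) hunif (Filter.Eventually.of_forall fun n =>
    (FormalMultilinearSeries.partialSum_continuous _ n).continuousOn)
  simp only [cfc_partialSum_binomialSeries a _ hx] at hcfc
  have hsum := (hasFPowerSeriesOnBall_binomialSeries A a).tendsto_partialSum (y := x)
    (by rwa [← ENNReal.ofReal_one, Metric.eball_ofReal, mem_ball_zero_iff])
  rw [zero_add] at hsum
  exact tendsto_nhds_unique hcfc hsum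

theorem contDiff_star : ContDiff ℝ ∞ (star : A → A) := (starL' ℝ : A ≃L[ℝ] A).contDiff

variable [PartialOrder A] [StarOrderedRing A]

theorem sqrt_one_add_eq_sum_binomialSeries [NormOneClass A] {x : A} (hx : 0 ≤ 1 + x)
    (hx1 : ‖x‖ < 1) : CFC.sqrt (1 + x) = (binomialSeries A (1 / 2 : ℝ)).sum x := by
  have hself : IsSelfAdjoint x := by simpa using hx.isSelfAdjoint.sub (.one A)
  have hone_add : cfc (fun y : ℝ => 1 + y) x = 1 + x := by
    rw [cfc_const_add 1 (fun y => y) x, cfc_id' ℝ x, map_one]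
  rw [← cfc_one_add_rpow_eq_sum_binomialSeries _ hself hx1, CFC.sqrt_eq_real_sqrt _ hx,
    cfcₙ_eq_cfc, ← hone_add, ← cfc_comp' Real.sqrt (fun y => 1 + y) x]
  simp only [Real.sqrt_eq_rpow]

theorem isUnit_one_add_of_nonneg {x : A} (hx : 0 ≤ x) : IsUnit (1 + x) :=
  CStarAlgebra.isUnit_of_le 1 (le_add_of_nonneg_right hx)

theorem ringInverse_one_add_eq_cfc {x : A} (hx : 0 ≤ x) :
    Ring.inverse (1 + x) = cfc (fun t : ℝ => (1 + t)⁻¹) x := by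
  have hspec : ∀ t ∈ spectrum ℝ x, 1 + t ≠ 0 := fun t ht => by
    have := spectrum_nonneg_of_nonneg hx ht
    positivity
  rw [cfc_inv (fun t : ℝ => 1 + t) x hspec, cfc_const_add 1 (fun t => t) x, cfc_id' ℝ x, map_one]

theorem ringInverse_one_add_nonneg {x : A} (hx : 0 ≤ x) : 0 ≤ Ring.inverse (1 + x) := by
  rw [ringInverse_one_add_eq_cfc hx]
  refine cfc_nonneg fun t ht => ?_
  have := spectrum_nonneg_of_nonneg hx ht
  positivity

theorem norm_ringInverse_one_add_sub_one_lt_one {x : A} (hx : 0 ≤ x) :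
    ‖Ring.inverse (1 + x) - 1‖ < 1 := by
  have hpos : ∀ t ∈ spectrum ℝ x, 0 < 1 + t := fun t ht => by
    have := spectrum_nonneg_of_nonneg hx ht
    positivity
  have hcont : ContinuousOn (fun t : ℝ => (1 + t)⁻¹) (spectrum ℝ x) :=
    ContinuousOn.inv₀ (by fun_prop) fun t ht => (hpos t ht).ne'
  rw [ringInverse_one_add_eq_cfc hx, ← cfc_const_one ℝ x, ← cfc_sub _ _ x hcont (by fun_prop)]
  refine norm_cfc_lt one_pos fun t ht => ?_
  have hinv_pos : 0 < (1 + t)⁻¹ := inv_pos.2 (hpos t ht)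
  have hinv_le : (1 + t)⁻¹ ≤ 1 :=
    inv_le_one_of_one_le₀ (le_add_of_nonneg_right (spectrum_nonneg_of_nonneg hx ht))
  rw [Real.norm_eq_abs, abs_lt]
  constructor <;> linarith

/-- The binomial series applies at every `a`, since `(1 + a* a)⁻¹` is always at distance less than
one from the identity. -/
theorem contDiff_sqrt_ringInverse_one_add_star_mul_self :
    ContDiff ℝ ∞ fun a : A => CFC.sqrt (Ring.inverse (1 + star a * a)) := by
  nontriviality A
  have hinv : ContDiff ℝ ∞ fun a : A => Ring.inverse (1 + star a * a) - 1 := by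
    refine ContDiff.sub (contDiff_iff_contDiffAt.2 fun a => ?_) contDiff_const
    obtain ⟨v, hv⟩ := isUnit_one_add_of_nonneg (star_mul_self_nonneg a)
    have hi := contDiffAt_ringInverse ℝ (n := ∞) v
    rw [hv] at hi
    exact hi.comp a (contDiff_const.add (contDiff_star.mul contDiff_id)).contDiffAt
  have hseries : ContDiffOn ℝ ∞ (binomialSeries A (1 / 2 : ℝ)).sum (Metric.ball 0 1) := by
    have h := (hasFPowerSeriesOnBall_binomialSeries A (1 / 2)).analyticOnNhd
    rw [← ENNReal.ofReal_one, Metric.eball_ofReal] at h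
    exact h.contDiffOn Metric.isOpen_ball.uniqueDiffOn
  have hsqrt : (fun a : A => CFC.sqrt (Ring.inverse (1 + star a * a))) =
      (binomialSeries A (1 / 2 : ℝ)).sum ∘ fun a => Ring.inverse (1 + star a * a) - 1 := by
    funext a
    rw [Function.comp_apply, ← sqrt_one_add_eq_sum_binomialSeries, add_sub_cancel]
    · rw [add_sub_cancel]
      exact ringInverse_one_add_nonneg (star_mul_self_nonneg a)
    · exact norm_ringInverse_one_add_sub_one_lt_one (star_mul_self_nonneg a)
  rw [hsqrt]
  exact hseries.comp_contDiff hinv fun a =>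
    mem_ball_zero_iff.2 (norm_ringInverse_one_add_sub_one_lt_one (star_mul_self_nonneg a))

end CStarAlgebra

/-! ### Graphs over the range of a projection -/

section OffDiagonal

variable {R : Type*} [Ring R] {p a : R}

/-- The off-diagonal corner `(1 - p) R p`: for an algebra of operators and a projection `p` with
range `W` these are the operators `W → Wᗮ`, extended by zero. -/
def IsOffDiag (p a : R) : Prop := (1 - p) * a * p = a

/-- The graph coordinate relative to `p`, as a function of an arbitrary element in place of the
second projection. -/
def graphCoordOp (p q : R) : R := (1 - p) * q * p * Ring.inverse (p * q * p + (1 - p)) * p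

/-- The element `p q + (1 - p) (1 - q)`, which for idempotents satisfies `p v = v q`. It is
invertible exactly when `q` is in the graph chart at `p`. -/
def intertwiner (p q : R) : R := p * q + (1 - p) * (1 - q)

/-- `Q` is the oblique projection onto the range of `q` along the kernel of `p`. -/
structure IsOblique (p q Q : R) : Prop where
  mul_left : q * Q = Q
  mul_right : Q * q = q
  proj_mul : p * Q = p
  mul_proj : Q * p = Q

namespace IsOffDiag

theorem proj_mul (hp : IsIdempotentElem p) (ha : IsOffDiag p a) : p * a = 0 := by
  rw [← ha, ← mul_assoc, ← mul_assoc, hp.mul_one_sub_self, zero_mul, zero_mul]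

theorem mul_proj (hp : IsIdempotentElem p) (ha : IsOffDiag p a) : a * p = a := by
  rw [← ha, mul_assoc, hp.eq]

theorem of_proj_mul_of_mul_proj (h₁ : p * a = 0) (h₂ : a * p = a) : IsOffDiag p a := by
  rw [IsOffDiag, mul_assoc, h₂, sub_mul, h₁, one_mul, sub_zero]

theorem proj_mul_add (hp : IsIdempotentElem p) (ha : IsOffDiag p a) : p * (p + a) = p := by
  rw [mul_add, hp.eq, ha.proj_mul hp, add_zero]

theorem add_mul_proj (hp : IsIdempotentElem p) (ha : IsOffDiag p a) : (p + a) * p = p + a := by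
  rw [add_mul, hp.eq, ha.mul_proj hp]

theorem one_sub_mul_add (hp : IsIdempotentElem p) (ha : IsOffDiag p a) :
    (1 - p) * (p + a) = a := by
  rw [sub_mul, one_mul, ha.proj_mul_add hp, add_sub_cancel_left]

variable [StarRing R]

theorem proj_mul_star (hp : IsStarProjection p) (ha : IsOffDiag p a) : p * star a = star a := by
  simpa only [star_mul, hp.isSelfAdjoint.star_eq] using
    congrArg star (ha.mul_proj hp.isIdempotentElem)

theorem star_mul_proj (hp : IsStarProjection p) (ha : IsOffDiag p a) : star a * p = 0 := by
  simpa only [star_mul, hp.isSelfAdjoint.star_eq, star_zero] using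
    congrArg star (ha.proj_mul hp.isIdempotentElem)

theorem add_star_mul_proj (hp : IsStarProjection p) (ha : IsOffDiag p a) :
    (p + star a) * p = p := by
  rw [add_mul, hp.isIdempotentElem.eq, ha.star_mul_proj hp, add_zero]

theorem add_star_mul_add (hp : IsStarProjection p) (ha : IsOffDiag p a) :
    (p + star a) * (p + a) = (1 + star a * a) * p := by
  rw [mul_add, ha.add_star_mul_proj hp, add_mul, ha.proj_mul hp.isIdempotentElem, zero_add,
    add_mul, one_mul, mul_assoc, ha.mul_proj hp.isIdempotentElem]

theorem commute_one_add_star_mul_self (hp : IsStarProjection p) (ha : IsOffDiag p a) :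
    Commute (1 + star a * a) p := by
  refine (Commute.one_left _).add_left ?_
  rw [commute_iff_eq, mul_assoc, ha.mul_proj hp.isIdempotentElem, ← mul_assoc,
    ha.proj_mul_star hp]

end IsOffDiag

namespace IsOblique

variable {q Q : R}

theorem isOffDiag_sub (h : IsOblique p q Q) (hp : IsIdempotentElem p) : IsOffDiag p (Q - p) :=
  .of_proj_mul_of_mul_proj (by rw [mul_sub, h.proj_mul, hp.eq, sub_self])
    (by rw [sub_mul, h.mul_proj, hp.eq])

theorem mul_eq_of_isOblique {q' : R} (h : IsOblique p q Q) (h' : IsOblique p q' Q) :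
    q * q' = q' := by
  rw [← h'.mul_right, ← mul_assoc, h.mul_left]

theorem exists_of_isUnit (hp : IsIdempotentElem p) (hq : IsIdempotentElem q)
    (h : IsUnit (intertwiner p q)) : ∃ Q, IsOblique p q Q := by
  obtain ⟨v, hv⟩ := h
  have proj_mul_v : p * v = p * q := by
    rw [hv, intertwiner, mul_add, ← mul_assoc, hp.eq, ← mul_assoc, hp.mul_one_sub_self, zero_mul,
      add_zero]
  have v_mul : v * q = p * q := by
    rw [hv, intertwiner, add_mul, mul_assoc, hq.eq, mul_assoc, hq.one_sub_mul_self, mul_zero,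
      add_zero]
  have mul_v_inv : q * ↑v⁻¹ = ↑v⁻¹ * p := by
    rw [Units.mul_inv_eq_iff_eq_mul, mul_assoc, proj_mul_v, ← v_mul, Units.inv_mul_cancel_left]
  refine ⟨q * ↑v⁻¹, ?_, ?_, ?_, ?_⟩
  · rw [← mul_assoc, hq.eq]
  · rw [mul_v_inv, mul_assoc, ← v_mul, Units.inv_mul_cancel_left]
  · rw [← mul_assoc, ← proj_mul_v, Units.mul_inv_cancel_right]
  · rw [mul_v_inv, mul_assoc, hp.eq]

variable [StarRing R]

theorem eq_of_isOblique {q' : R} (h : IsOblique p q Q) (h' : IsOblique p q' Q)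
    (hq : IsSelfAdjoint q) (hq' : IsSelfAdjoint q') : q = q' := by
  have hstar := congrArg star (h.mul_eq_of_isOblique h')
  rw [star_mul, hq.star_eq, hq'.star_eq, h'.mul_eq_of_isOblique h] at hstar
  exact hstar

theorem star_mul_intertwiner (h : IsOblique p q Q) (hp : IsStarProjection p)
    (hq : IsSelfAdjoint q) : (Q + (1 - star Q) * (1 - p)) * intertwiner p q = 1 := by
  have star_mul_q : star Q * q = star Q := by
    simpa only [star_mul, hq.star_eq] using congrArg star h.mul_left
  have star_mul_p : star Q * p = p := by
    simpa only [star_mul, hp.isSelfAdjoint.star_eq] using congrArg star h.proj_mul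
  calc (Q + (1 - star Q) * (1 - p)) * intertwiner p q
      = Q * p * q + (Q - Q * p) * (1 - q) + (1 - star Q) * ((1 - p) * p) * q
        + (1 - star Q) * ((1 - p) * (1 - p)) * (1 - q) := by rw [intertwiner]; noncomm_ring
    _ = q + (1 - p - star Q + star Q * p - q + p * q + star Q * q - star Q * p * q) := by
        rw [hp.one_sub_mul_self, hp.one_sub.isIdempotentElem.eq, h.mul_proj, h.mul_right]
        noncomm_ring
    _ = 1 := by rw [star_mul_p, star_mul_q]; abel

theorem intertwiner_mul_star (h : IsOblique p q Q) (hp : IsStarProjection p)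
    (hq : IsSelfAdjoint q) : intertwiner p q * (Q + (1 - star Q) * (1 - p)) = 1 := by
  have mul_star_q : q * star Q = q := by
    simpa only [star_mul, hq.star_eq] using congrArg star h.mul_right
  have mul_star_p : p * star Q = star Q := by
    simpa only [star_mul, hp.isSelfAdjoint.star_eq] using congrArg star h.mul_proj
  calc intertwiner p q * (Q + (1 - star Q) * (1 - p))
      = p * (q * Q) + p * (q - q * star Q) * (1 - p) + (1 - p) * (Q - q * Q)
        + (1 - p) * (1 - q - (star Q - q * star Q)) * (1 - p) := by
        rw [intertwiner]; noncomm_ring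
    _ = p + ((1 - p) * (1 - p) - (star Q - p * star Q) * (1 - p)) := by
        rw [h.mul_left, mul_star_q, h.proj_mul]
        noncomm_ring
    _ = 1 := by rw [hp.one_sub.isIdempotentElem.eq, mul_star_p]; noncomm_ring

theorem isUnit_intertwiner (h : IsOblique p q Q) (hp : IsStarProjection p)
    (hq : IsSelfAdjoint q) : IsUnit (intertwiner p q) :=
  ⟨⟨_, _, h.intertwiner_mul_star hp hq, h.star_mul_intertwiner hp hq⟩, rfl⟩

end IsOblique

end OffDiagonal

section GraphSection

theorem commute_ringInverse_left {R : Type*} [MonoidWithZero R] {a b : R} (ha : IsUnit a)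
    (h : Commute a b) : Commute (Ring.inverse a) b := by
  obtain ⟨v, rfl⟩ := ha
  rw [Ring.inverse_unit]
  exact h.units_inv_left

variable {A : Type*} [CStarAlgebra A] [PartialOrder A] [StarOrderedRing A] {p a : A}

/-- The partial isometry `(p + a) (1 + a* a)^{-1/2}` from the range of `p` onto the graph
of `a`. -/
def graphSection (p a : A) : A := (p + a) * CFC.sqrt (Ring.inverse (1 + star a * a)) * p

theorem commute_sqrt_left {b c : A} (h : Commute b c) : Commute (CFC.sqrt b) c :=
  h.cfcₙ_nnreal _

theorem isUnit_one_add_star_mul_self (a : A) : IsUnit (1 + star a * a) :=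
  isUnit_one_add_of_nonneg (star_mul_self_nonneg a)

theorem sqrt_ringInverse_one_add_star_mul_self (a : A) :
    CFC.sqrt (Ring.inverse (1 + star a * a)) * CFC.sqrt (Ring.inverse (1 + star a * a)) =
      Ring.inverse (1 + star a * a) :=
  CFC.sqrt_mul_sqrt_self _ (ringInverse_one_add_nonneg (star_mul_self_nonneg a))

theorem sqrt_mul_one_add_star_mul_self_mul_sqrt (a : A) :
    CFC.sqrt (Ring.inverse (1 + star a * a)) * (1 + star a * a) *
      CFC.sqrt (Ring.inverse (1 + star a * a)) = 1 := by
  have hu := isUnit_one_add_star_mul_self a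
  rw [(commute_sqrt_left (commute_ringInverse_left hu (Commute.refl _))).eq, mul_assoc,
    sqrt_ringInverse_one_add_star_mul_self, Ring.mul_inverse_cancel _ hu]

namespace IsOffDiag

theorem commute_ringInverse (hp : IsStarProjection p) (ha : IsOffDiag p a) :
    Commute (Ring.inverse (1 + star a * a)) p :=
  commute_ringInverse_left (isUnit_one_add_star_mul_self a) (ha.commute_one_add_star_mul_self hp)

theorem graphSection_eq (hp : IsStarProjection p) (ha : IsOffDiag p a) :
    graphSection p a = (p + a) * CFC.sqrt (Ring.inverse (1 + star a * a)) := by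
  rw [graphSection, mul_assoc, (commute_sqrt_left (ha.commute_ringInverse hp)).eq, ← mul_assoc,
    ha.add_mul_proj hp.isIdempotentElem]

theorem star_graphSection (hp : IsStarProjection p) (ha : IsOffDiag p a) :
    star (graphSection p a) = CFC.sqrt (Ring.inverse (1 + star a * a)) * (p + star a) := by
  rw [ha.graphSection_eq hp, star_mul, star_add, hp.isSelfAdjoint.star_eq,
    (CFC.sqrt_nonneg _).isSelfAdjoint.star_eq]

theorem star_graphSection_mul_self (hp : IsStarProjection p) (ha : IsOffDiag p a) :
    star (graphSection p a) * graphSection p a = p := by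
  have hcomm := commute_sqrt_left (ha.commute_ringInverse hp)
  rw [ha.star_graphSection hp, ha.graphSection_eq hp]
  calc _ = CFC.sqrt (Ring.inverse (1 + star a * a)) * ((p + star a) * (p + a)) *
        CFC.sqrt (Ring.inverse (1 + star a * a)) := by simp only [mul_assoc]
    _ = CFC.sqrt (Ring.inverse (1 + star a * a)) * (1 + star a * a) *
        CFC.sqrt (Ring.inverse (1 + star a * a)) * p := by
      rw [ha.add_star_mul_add hp, ← mul_assoc, mul_assoc _ p, ← hcomm.eq, ← mul_assoc]
    _ = p := by rw [sqrt_mul_one_add_star_mul_self_mul_sqrt, one_mul]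

theorem graphSection_mul_star (hp : IsStarProjection p) (ha : IsOffDiag p a) :
    graphSection p a * star (graphSection p a) =
      (p + a) * Ring.inverse (1 + star a * a) * (p + star a) := by
  rw [ha.star_graphSection hp, ha.graphSection_eq hp, ← mul_assoc, mul_assoc (p + a),
    sqrt_ringInverse_one_add_star_mul_self]

theorem isOblique_graphSection_mul_star (hp : IsStarProjection p) (ha : IsOffDiag p a) :
    IsOblique p (graphSection p a * star (graphSection p a)) (p + a) := by
  have hp' := hp.isIdempotentElem
  have hidem : (p + a) * (p + a) = p + a := by
    nth_rw 1 [← ha.add_mul_proj hp', mul_assoc, ha.proj_mul_add hp', ha.add_mul_proj hp']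
  refine ⟨?_, ?_, ha.proj_mul_add hp', ha.add_mul_proj hp'⟩
  · rw [ha.graphSection_mul_star hp, mul_assoc, ha.add_star_mul_add hp, mul_assoc,
      ← mul_assoc _ _ p, Ring.inverse_mul_cancel _ (isUnit_one_add_star_mul_self a), one_mul,
      ha.add_mul_proj hp']
  · rw [ha.graphSection_mul_star hp, ← mul_assoc, ← mul_assoc, hidem]

theorem compression_graphSection_mul_star (hp : IsStarProjection p) (ha : IsOffDiag p a) :
    p * (graphSection p a * star (graphSection p a)) * p + (1 - p) =
      Ring.inverse (1 + star a * a) := by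
  have hp' := hp.isIdempotentElem
  have hu := isUnit_one_add_star_mul_self a
  have on_range : p * (graphSection p a * star (graphSection p a)) * p =
      Ring.inverse (1 + star a * a) * p := by
    rw [ha.graphSection_mul_star hp]
    calc _ = p * (p + a) * Ring.inverse (1 + star a * a) * ((p + star a) * p) := by
          simp only [mul_assoc]
      _ = _ := by
          rw [ha.proj_mul_add hp', ha.add_star_mul_proj hp, ← (ha.commute_ringInverse hp).eq,
            mul_assoc, hp'.eq]
  have on_ker : Ring.inverse (1 + star a * a) * (1 - p) = 1 - p := by
    rw [Ring.inverse_mul_eq_iff_eq_mul _ _ _ hu, add_mul, one_mul, mul_assoc, mul_sub, mul_one,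
      ha.mul_proj hp', sub_self, mul_zero, add_zero]
  rw [on_range, ← on_ker, ← mul_add, add_sub_cancel, mul_one]

theorem graphCoordOp_graphSection_mul_star (hp : IsStarProjection p) (ha : IsOffDiag p a) :
    graphCoordOp p (graphSection p a * star (graphSection p a)) = a := by
  have hp' := hp.isIdempotentElem
  have hu := isUnit_one_add_star_mul_self a
  rw [graphCoordOp, ha.compression_graphSection_mul_star hp, Ring.inverse_inverse hu,
    ha.graphSection_mul_star hp]
  calc _ = (1 - p) * (p + a) * Ring.inverse (1 + star a * a) * ((p + star a) * p) *
        ((1 + star a * a) * p) := by simp only [mul_assoc]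
    _ = a * Ring.inverse (1 + star a * a) * (p * ((1 + star a * a) * p)) := by
        rw [ha.one_sub_mul_add hp', ha.add_star_mul_proj hp, mul_assoc]
    _ = a * (Ring.inverse (1 + star a * a) * (1 + star a * a)) * p := by
        rw [← mul_assoc p, ← (ha.commute_one_add_star_mul_self hp).eq, mul_assoc _ p, hp'.eq]
        simp only [mul_assoc]
    _ = a := by rw [Ring.inverse_mul_cancel _ hu, mul_one, ha.mul_proj hp']

end IsOffDiag

end GraphSection

section GraphDomain

theorem isCompl_range_ker_iff_exists_isOblique {𝕜 E : Type*} [NontriviallyNormedField 𝕜]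
    [NormedAddCommGroup E] [NormedSpace 𝕜 E] [CompleteSpace E] {p q : E →L[𝕜] E}
    (hp : IsIdempotentElem p) (hq : IsIdempotentElem q) :
    IsCompl q.range p.ker ↔ ∃ Q, IsOblique p q Q := by
  have mem_range (x : E) : x ∈ q.range ↔ q x = x :=
    ⟨by rintro ⟨y, rfl⟩; exact DFunLike.congr_fun hq.eq y, fun h => ⟨x, h⟩⟩
  have proj_sub (x : E) : p (p x - x) = 0 := by
    rw [map_sub, sub_eq_zero]; exact DFunLike.congr_fun hp.eq x
  constructor
  · intro h
    have hT := Submodule.IsCompl.isTopCompl_of_isClosed h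
      (ContinuousLinearMap.IsIdempotentElem.isClosed_range hq) p.isClosed_ker
    refine ⟨Submodule.projectionL _ _ hT, ?_, ?_, ?_, ?_⟩ <;> ext x
    · exact (mem_range _).1 (Submodule.projectionL_apply_mem hT x)
    · exact Submodule.projectionL_apply_left hT ⟨q x, ⟨x, rfl⟩⟩
    · have hmem := Submodule.projectionL_apply_mem hT.symm x
      rw [Submodule.projectionL_eq_self_sub_projectionL hT] at hmem
      exact (sub_eq_zero.1 ((map_sub p _ _).symm.trans hmem)).symm
    · change Submodule.projectionL _ _ hT (p x) = Submodule.projectionL _ _ hT x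
      rw [← sub_eq_zero, ← map_sub, Submodule.projectionL_apply_eq_zero_iff]
      exact proj_sub x
  · rintro ⟨Q, h⟩
    refine IsCompl.of_le (fun x ⟨hx, hx'⟩ => ?_) (fun x _ => ?_)
    · have hpx : p x = 0 := hx'
      calc x = (Q * q) x := by rw [h.mul_right, (mem_range x).1 hx]
        _ = Q (q x) := rfl
        _ = (Q * p) x := by rw [h.mul_proj, (mem_range x).1 hx]
        _ = Q (p x) := rfl
        _ = 0 := by rw [hpx, map_zero]
    · refine Submodule.mem_sup.2 ⟨Q x, (mem_range _).2 (DFunLike.congr_fun h.mul_left x), x - Q x,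
        ?_, add_sub_cancel _ _⟩
      change p (x - Q x) = 0
      rw [map_sub, sub_eq_zero]
      exact (DFunLike.congr_fun h.proj_mul x).symm

variable {H : Type u} [NormedAddCommGroup H] [InnerProductSpace ℂ H] [CompleteSpace H]
  {p q : Proj H} {A : H →L[ℂ] H}

theorem mem_graphDomain_iff_exists_isOblique :
    q ∈ graphDomain p ↔ ∃ Q, IsOblique p.1 q.1 Q := by
  rw [← isCompl_range_ker_iff_exists_isOblique p.2.isIdempotentElem q.2.isIdempotentElem,
    ← ContinuousLinearMap.IsStarNormal.orthogonal_range p.2.isSelfAdjoint.isStarNormal]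
  rfl

theorem mem_graphDomain_iff_isUnit : q ∈ graphDomain p ↔ IsUnit (intertwiner p.1 q.1) := by
  rw [mem_graphDomain_iff_exists_isOblique]
  exact ⟨fun ⟨_, h⟩ => h.isUnit_intertwiner p.2 q.2.isSelfAdjoint,
    IsOblique.exists_of_isUnit p.2.isIdempotentElem q.2.isIdempotentElem⟩

/-- The cross-section of the Grassmannian over the graph chart at `p`: the partial isometry from
the range of `p` onto the graph of `A`. -/
def graphPIso (p : Proj H) (A : H →L[ℂ] H) (hA : A ∈ offDiag p) : PIso H :=
  ⟨graphSection p.1 A, (IsOffDiag.star_graphSection_mul_self p.2 hA).symm ▸ p.2⟩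

/-- The orthogonal projection onto the graph of `A`. -/
def graphProj (p : Proj H) (A : H →L[ℂ] H) (hA : A ∈ offDiag p) : Proj H :=
  (graphPIso p A hA).tgt

theorem isOblique_graphProj (hA : A ∈ offDiag p) : IsOblique p.1 (graphProj p A hA).1 (p.1 + A) :=
  IsOffDiag.isOblique_graphSection_mul_star p.2 hA

theorem graphCoord_graphProj (hA : A ∈ offDiag p) : graphCoord p (graphProj p A hA) = A :=
  IsOffDiag.graphCoordOp_graphSection_mul_star p.2 hA

theorem graphProj_mem_graphDomain (hA : A ∈ offDiag p) : graphProj p A hA ∈ graphDomain p :=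
  mem_graphDomain_iff_exists_isOblique.2 ⟨_, isOblique_graphProj hA⟩

theorem graphProj_graphCoord (h : q ∈ graphDomain p) :
    graphProj p (graphCoord p q) (graphCoord_mem p q) = q := by
  obtain ⟨Q, hQ⟩ := mem_graphDomain_iff_exists_isOblique.1 h
  have hoff : Q - p.1 ∈ offDiag p := hQ.isOffDiag_sub p.2.isIdempotentElem
  have hob := isOblique_graphProj hoff
  rw [add_sub_cancel] at hob
  have hq : q = graphProj p (Q - p.1) hoff :=
    Subtype.ext (hQ.eq_of_isOblique hob q.2.isSelfAdjoint (graphProj p _ hoff).2.isSelfAdjoint)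
  have hcoord : graphCoord p q = Q - p.1 := by rw [hq, graphCoord_graphProj]
  simp only [hcoord, ← hq]

end GraphDomain

/-! ### The Cayley transform in a corner -/

section Corner

theorem two_mul_ringInverse_sub_one_mul {R : Type*} [Ring R] {a b : R} (ha : IsUnit a)
    (hb : IsUnit b) (h : a + b = 2) :
    (2 * Ring.inverse a - 1) * (2 * Ring.inverse b - 1) = 1 := by
  have hsum : Ring.inverse a * 2 * Ring.inverse b = Ring.inverse a + Ring.inverse b := by
    rw [← h, mul_add, add_mul, Ring.inverse_mul_cancel _ ha, one_mul, mul_assoc,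
      Ring.mul_inverse_cancel _ hb, mul_one, add_comm]
  calc (2 * Ring.inverse a - 1) * (2 * Ring.inverse b - 1)
      = 2 * (Ring.inverse a * 2 * Ring.inverse b) - 2 * Ring.inverse a - 2 * Ring.inverse b
        + 1 := by noncomm_ring
    _ = 1 := by rw [hsum]; noncomm_ring

variable {R : Type*} [Ring R] {p g x : R}

/-- For `g` in the corner `p R p` with `1 + g` invertible, the inverse of `p + g` in that
corner. -/
def cornerInverse (p g : R) : R := p * Ring.inverse (1 + g) * p

/-- The inverse Cayley transform `(1 + x) (1 - x)⁻¹ p`, with `(1 + x) (1 - x)⁻¹` written as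
`2 (1 - x)⁻¹ - 1`. -/
def cayleyInv (p x : R) : R := (2 * Ring.inverse (1 - x) - 1) * p

theorem mul_add_cayleyInv (p : R) (hu : IsUnit (1 - x)) :
    (1 - x) * (p + cayleyInv p x) = 2 * p := by
  have hadd : p + cayleyInv p x = Ring.inverse (1 - x) * (2 * p) := by
    rw [cayleyInv]; noncomm_ring
  rw [hadd, Ring.mul_inverse_cancel_left _ _ hu]

variable [StarRing R]

/-- `g` is a unitary of the corner `p R p`, that is, a unitary operator on the range of `p`
extended by zero. -/
structure IsUnitaryInCorner (p g : R) : Prop where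
  proj_mul : p * g = g
  mul_proj : g * p = g
  star_mul_self : star g * g = p
  mul_star_self : g * star g = p

/-- `x` is a skew-adjoint element of the corner `p R p`. -/
def IsSkewInCorner (p x : R) : Prop := star x = -x ∧ p * x * p = x

namespace IsUnitaryInCorner

theorem star_mul_proj (hp : IsSelfAdjoint p) (h : IsUnitaryInCorner p g) :
    star g * p = star g := by
  simpa only [star_mul, hp.star_eq] using congrArg star h.proj_mul

theorem cornerInverse_mul (hp : IsIdempotentElem p) (h : IsUnitaryInCorner p g)
    (hu : IsUnit (1 + g)) : cornerInverse p g * (p + g) = p := by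
  have hcomm : p * (1 + g) = (1 + g) * p := by
    rw [mul_add, add_mul, h.proj_mul, h.mul_proj, mul_one, one_mul]
  calc cornerInverse p g * (p + g) = p * Ring.inverse (1 + g) * (p * (1 + g)) := by
        rw [cornerInverse, mul_assoc _ p, mul_add p 1, mul_add p p, mul_one, hp.eq]
    _ = p := by
        rw [hcomm, mul_assoc, ← mul_assoc _ (1 + g), Ring.inverse_mul_cancel _ hu, one_mul, hp.eq]

theorem mul_cornerInverse (hp : IsIdempotentElem p) (h : IsUnitaryInCorner p g)
    (hu : IsUnit (1 + g)) : (p + g) * cornerInverse p g = p := by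
  calc (p + g) * cornerInverse p g = (p + g) * p * Ring.inverse (1 + g) * p := by
        simp only [cornerInverse, mul_assoc]
    _ = p * (1 + g) * Ring.inverse (1 + g) * p := by
        rw [add_mul p g, h.mul_proj, mul_add, h.proj_mul, mul_one, hp.eq]
    _ = p := by rw [mul_assoc p, Ring.mul_inverse_cancel _ hu, mul_one, hp.eq]

/-! With `c` the inverse of `p + g` in the corner, `c* (g - g*) c = c* - c` because
`g - g* = (p + g) - (p + g*)`, and `c* + c = p` because `(p + g*) (p + g) = (p + g) + (p + g*)`. -/

theorem star_cornerInverse_mul_sub_mul (hp : IsStarProjection p) (h : IsUnitaryInCorner p g)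
    (hu : IsUnit (1 + g)) :
    star (cornerInverse p g) * (g - star g) * cornerInverse p g = p - 2 * cornerInverse p g := by
  have hpc : p * cornerInverse p g = cornerInverse p g := by
    simp only [cornerInverse, ← mul_assoc, hp.isIdempotentElem.eq]
  have hcp : star (cornerInverse p g) * p = star (cornerInverse p g) := by
    simpa only [star_mul, hp.isSelfAdjoint.star_eq] using congrArg star hpc
  have hc := h.mul_cornerInverse hp.isIdempotentElem hu
  have hc' : star (cornerInverse p g) * (p + star g) = p := by
    simpa only [star_mul, star_add, hp.isSelfAdjoint.star_eq] using congrArg star hc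
  have hsq : (p + star g) * (p + g) = (p + g) + (p + star g) := by
    rw [add_mul, mul_add, mul_add, hp.isIdempotentElem.eq, h.proj_mul, h.star_mul_self,
      h.star_mul_proj hp.isSelfAdjoint, add_comm (star g)]
  generalize cornerInverse p g = c at *
  have hsum : star c + c = p := by
    calc star c + c = star c * ((p + g) * c) + star c * (p + star g) * c := by
          rw [hc, hc', hcp, hpc]
      _ = star c * ((p + star g) * (p + g)) * c := by rw [hsq]; noncomm_ring
      _ = star c * (p + star g) * ((p + g) * c) := by noncomm_ring
      _ = p := by rw [hc, hc', hp.isIdempotentElem.eq]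
  calc star c * (g - star g) * c
      = star c * ((p + g) * c) - star c * (p + star g) * c := by noncomm_ring
    _ = star c - c := by rw [hc, hc', hcp, hpc]
    _ = p - 2 * c := by rw [eq_sub_of_add_eq hsum]; noncomm_ring

theorem cayleyInv_eq (hp : IsIdempotentElem p) (h : IsUnitaryInCorner p g) (hu : IsUnit (1 + g))
    (hx : p - 2 * cornerInverse p g = x) (hu' : IsUnit (1 - x)) : cayleyInv p x = g := by
  have hxp : x * p = x := by
    rw [← hx, cornerInverse, sub_mul, hp.eq, mul_assoc, mul_assoc, hp.eq]
  have hmul : (1 - x) * (p + g) = 2 * p := by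
    calc (1 - x) * (p + g) = (p - x * p) * (p + g) := by
          rw [sub_mul, sub_mul, mul_assoc x, mul_add p, hp.eq, h.proj_mul, one_mul]
      _ = 2 * (cornerInverse p g * (p + g)) := by rw [hxp, ← hx]; noncomm_ring
      _ = 2 * p := by rw [h.cornerInverse_mul hp hu]
  calc cayleyInv p x = Ring.inverse (1 - x) * (2 * p) - p := by rw [cayleyInv]; noncomm_ring
    _ = g := by
        rw [← hmul, Ring.inverse_mul_cancel_left _ _ hu', add_sub_cancel_left]

end IsUnitaryInCorner

namespace IsSkewInCorner

theorem proj_mul (hp : IsIdempotentElem p) (h : IsSkewInCorner p x) : p * x = x := by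
  rw [← h.2, ← mul_assoc, ← mul_assoc, hp.eq]

theorem mul_proj (hp : IsIdempotentElem p) (h : IsSkewInCorner p x) : x * p = x := by
  rw [← h.2, mul_assoc, hp.eq]

theorem cayleyInv_eq_proj_mul (hp : IsIdempotentElem p) (h : IsSkewInCorner p x)
    (hu : IsUnit (1 - x)) : cayleyInv p x = p * (2 * Ring.inverse (1 - x) - 1) := by
  have hcomm : Commute (Ring.inverse (1 - x)) p :=
    commute_ringInverse_left hu <| (Commute.one_left p).sub_left <| by
      rw [commute_iff_eq, h.proj_mul hp, h.mul_proj hp]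
  exact (((Commute.ofNat_left 2 p).mul_left hcomm).sub_left (Commute.one_left p)).eq

theorem star_cayleyInv (hp : IsSelfAdjoint p) (h : IsSkewInCorner p x) :
    star (cayleyInv p x) = p * (2 * Ring.inverse (1 + x) - 1) := by
  simp only [cayleyInv, star_mul, star_sub, star_one, star_ofNat, hp.star_eq, ← Ring.inverse_star,
    h.1, sub_neg_eq_add, (Commute.ofNat_right (Ring.inverse (1 + x)) 2).eq]

theorem isUnitaryInCorner_cayleyInv (hp : IsStarProjection p) (h : IsSkewInCorner p x)
    (hu : IsUnit (1 - x)) (hu' : IsUnit (1 + x)) : IsUnitaryInCorner p (cayleyInv p x) := by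
  have hp' := hp.isIdempotentElem
  have hsum : (1 - x) + (1 + x) = 2 := by rw [sub_add_add_cancel, one_add_one_eq_two]
  have hcomm := h.cayleyInv_eq_proj_mul hp' hu
  refine ⟨?_, ?_, ?_, ?_⟩
  · rw [hcomm, ← mul_assoc, hp'.eq]
  · rw [cayleyInv, mul_assoc, hp'.eq]
  · rw [h.star_cayleyInv hp.isSelfAdjoint, cayleyInv, mul_assoc, ← mul_assoc _ _ p,
      two_mul_ringInverse_sub_one_mul hu' hu (by rw [add_comm, hsum]), one_mul, hp'.eq]
  · rw [h.star_cayleyInv hp.isSelfAdjoint, ← mul_assoc, cayleyInv, mul_assoc _ p p, hp'.eq,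
      ← cayleyInv, hcomm, mul_assoc, two_mul_ringInverse_sub_one_mul hu hu' hsum, mul_one]

theorem add_cayleyInv_mul (hp : IsIdempotentElem p) (h : IsSkewInCorner p x)
    (hu : IsUnit (1 - x)) : (p + cayleyInv p x) * (1 - x) = 2 * p := by
  have hadd : p + cayleyInv p x = p * Ring.inverse (1 - x) * 2 := by
    rw [h.cayleyInv_eq_proj_mul hp hu]; noncomm_ring
  rw [hadd, mul_assoc, two_mul, ← mul_two, mul_assoc, Ring.inverse_mul_cancel_left _ _ hu,
    mul_two, two_mul]

theorem isUnit_one_add_cayleyInv (h2 : IsUnit (2 : R)) (hp : IsIdempotentElem p)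
    (h : IsSkewInCorner p x) (hu : IsUnit (1 - x)) : IsUnit (1 + cayleyInv p x) := by
  have hl := mul_add_cayleyInv p hu
  have hr := h.add_cayleyInv_mul hp hu
  have hpg : p * (p + cayleyInv p x) = p + cayleyInv p x := by
    rw [mul_add, hp.eq, h.cayleyInv_eq_proj_mul hp hu, ← mul_assoc, hp.eq]
  have hgp : (p + cayleyInv p x) * p = p + cayleyInv p x := by
    rw [add_mul, hp.eq, cayleyInv, mul_assoc, hp.eq]
  have hpx : p * (1 - x) = (1 - x) * p := by
    rw [mul_sub, sub_mul, h.proj_mul hp, h.mul_proj hp, mul_one, one_mul]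
  have hg : 1 + cayleyInv p x = (1 - p) + (p + cayleyInv p x) := by abel
  have hright : (1 + cayleyInv p x) * (2 * (1 - p) + p * (1 - x)) = 2 := by
    rw [hg]
    generalize p + cayleyInv p x = e at *
    calc _ = 2 * ((1 - p) * (1 - p)) + (1 - p) * p * (1 - x) + 2 * (e - e * p)
          + e * p * (1 - x) := by noncomm_ring
      _ = 2 := by
        rw [hgp, hr, hp.one_sub_mul_self, hp.one_sub.eq]
        simp only [zero_mul, sub_self, mul_zero, add_zero, mul_sub, mul_one, sub_add_cancel]
  have hleft : (2 * (1 - p) + p * (1 - x)) * (1 + cayleyInv p x) = 2 := by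
    rw [hg, hpx]
    generalize p + cayleyInv p x = e at *
    calc _ = 2 * ((1 - p) * (1 - p)) + (1 - x) * (p * (1 - p)) + 2 * (e - p * e)
          + (1 - x) * (p * e) := by noncomm_ring
      _ = 2 := by
        rw [hpg, hl, hp.mul_one_sub_self, hp.one_sub.eq]
        simp only [sub_self, mul_zero, add_zero, mul_sub, mul_one, sub_add_cancel]
  have hcomm : Commute (1 + cayleyInv p x) (2 * (1 - p) + p * (1 - x)) := hright.trans hleft.symm
  exact (hcomm.isUnit_mul_iff.1 (by rwa [hright])).1

theorem sub_two_mul_cornerInverse_cayleyInv (hp : IsStarProjection p) (h : IsSkewInCorner p x)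
    (hu : IsUnit (1 - x)) (hu' : IsUnit (1 + x)) (hg : IsUnit (1 + cayleyInv p x)) :
    p - 2 * cornerInverse p (cayleyInv p x) = x := by
  have hp' := hp.isIdempotentElem
  have hcp : cornerInverse p (cayleyInv p x) * p = cornerInverse p (cayleyInv p x) := by
    rw [cornerInverse, mul_assoc, hp'.eq]
  calc p - 2 * cornerInverse p (cayleyInv p x)
      = p - cornerInverse p (cayleyInv p x) * (2 * p) := by
        rw [two_mul p, mul_add, hcp, two_mul]
    _ = p - cornerInverse p (cayleyInv p x) * (p + cayleyInv p x) * (1 - x) := by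
        rw [mul_assoc, h.add_cayleyInv_mul hp' hu]
    _ = x := by
        rw [(h.isUnitaryInCorner_cayleyInv hp hu hu').cornerInverse_mul hp' hg, mul_sub, mul_one,
          h.proj_mul hp', sub_sub_cancel]

end IsSkewInCorner

end Corner

section CornerCStar

variable {A : Type*} [CStarAlgebra A] [PartialOrder A] [StarOrderedRing A] {x : A}

theorem isUnit_one_sub_of_star_eq_neg (h : star x = -x) : IsUnit (1 - x) := by
  have hu := isUnit_one_add_star_mul_self x
  have hfactor : 1 + star x * x = (1 - x) * (1 + x) := by rw [h]; noncomm_ring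
  have hcomm : Commute (1 - x) (1 + x) := by
    rw [commute_iff_eq]; noncomm_ring
  rw [hfactor, hcomm.isUnit_mul_iff] at hu
  exact hu.1

theorem isUnit_one_add_of_star_eq_neg (h : star x = -x) : IsUnit (1 + x) := by
  rw [← sub_neg_eq_add]
  exact isUnit_one_sub_of_star_eq_neg (by rw [star_neg, h])

end CornerCStar

section CayleyCoord

variable {H : Type u} [NormedAddCommGroup H] [InnerProductSpace ℂ H] [CompleteSpace H]
  {p : Proj H} {g X : H →L[ℂ] H}

theorem isUnitaryInCorner_cayleyInv_of_mem (hX : X ∈ skewCorner p) :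
    IsUnitaryInCorner p.1 (cayleyInv p.1 X) :=
  IsSkewInCorner.isUnitaryInCorner_cayleyInv p.2 hX (isUnit_one_sub_of_star_eq_neg hX.1)
    (isUnit_one_add_of_star_eq_neg hX.1)

theorem isUnit_one_add_cayleyInv_of_mem (hX : X ∈ skewCorner p) :
    IsUnit (1 + cayleyInv p.1 X) := by
  have h2 : IsUnit (2 : H →L[ℂ] H) := by
    simpa only [map_ofNat] using
      (isUnit_iff_ne_zero.2 (two_ne_zero' ℂ)).map (algebraMap ℂ (H →L[ℂ] H))
  exact IsSkewInCorner.isUnit_one_add_cayleyInv h2 p.2.isIdempotentElem hX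
    (isUnit_one_sub_of_star_eq_neg hX.1)

theorem cayleyCoord_eq (hg : IsUnitaryInCorner p.1 g) (hu : IsUnit (1 + g)) :
    cayleyCoord p g = p.1 - 2 * cornerInverse p.1 g :=
  hg.star_cornerInverse_mul_sub_mul p.2 hu

theorem cayleyCoord_cayleyInv (hX : X ∈ skewCorner p) : cayleyCoord p (cayleyInv p.1 X) = X := by
  have hu := isUnit_one_add_cayleyInv_of_mem hX
  rw [cayleyCoord_eq (isUnitaryInCorner_cayleyInv_of_mem hX) hu]
  exact IsSkewInCorner.sub_two_mul_cornerInverse_cayleyInv p.2 hX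
    (isUnit_one_sub_of_star_eq_neg hX.1) (isUnit_one_add_of_star_eq_neg hX.1) hu

theorem cayleyInv_cayleyCoord (hg : IsUnitaryInCorner p.1 g) (hu : IsUnit (1 + g)) :
    cayleyInv p.1 (cayleyCoord p g) = g :=
  hg.cayleyInv_eq p.2.isIdempotentElem hu (cayleyCoord_eq hg hu).symm
    (isUnit_one_sub_of_star_eq_neg (cayleyCoord_mem p g).1)

end CayleyCoord

/-! ### Smoothness of the charts as functions of operators -/

section SmoothFormulas

variable {X : Type*} [NormedAddCommGroup X] [NormedSpace ℝ X] {s : Set X}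

theorem contDiffOn_ringInverse_comp {R : Type*} [NormedRing R] [NormedAlgebra ℝ R]
    [HasSummableGeomSeries R] {f : X → R} (hf : ContDiffOn ℝ ∞ f s) (h : ∀ x ∈ s, IsUnit (f x)) :
    ContDiffOn ℝ ∞ (fun x => Ring.inverse (f x)) s := fun x hx => by
  have hinv := contDiffAt_ringInverse ℝ (n := ∞) (h x hx).unit
  rw [IsUnit.unit_spec] at hinv
  exact hinv.comp_contDiffWithinAt x (hf x hx)

section Ring

variable {R : Type*} [NormedRing R] [NormedAlgebra ℝ R]

/-- The operators `q` at which the graph coordinate relative to `p` is defined and smooth, and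
which, if they are projections, are in the domain of the graph chart at `p`. -/
def graphDomainOp (p : R) : Set R :=
  {q | IsUnit (p * q * p + (1 - p)) ∧ IsUnit (intertwiner p q)}

theorem contDiff_intertwiner (p : R) : ContDiff ℝ ∞ (intertwiner p) :=
  (contDiff_const.mul contDiff_id).add (contDiff_const.mul (contDiff_const.sub contDiff_id))

theorem contDiff_compression (p : R) : ContDiff ℝ ∞ fun q : R => p * q * p + (1 - p) :=
  ((contDiff_const.mul contDiff_id).mul contDiff_const).add contDiff_const

variable [HasSummableGeomSeries R]

theorem isOpen_graphDomainOp (p : R) : IsOpen (graphDomainOp p) :=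
  (Units.isOpen.preimage (contDiff_compression p).continuous).inter
    (Units.isOpen.preimage (contDiff_intertwiner p).continuous)

theorem contDiffOn_graphCoordOp (p : R) : ContDiffOn ℝ ∞ (graphCoordOp p) (graphDomainOp p) :=
  (((contDiff_const.mul contDiff_id).mul contDiff_const).contDiffOn.mul
    (contDiffOn_ringInverse_comp (contDiff_compression p).contDiffOn fun _ hq => hq.1)).mul
      contDiffOn_const

theorem contDiffOn_cayleyInv (p : R) : ContDiffOn ℝ ∞ (cayleyInv p) {x | IsUnit (1 - x)} :=
  ((contDiffOn_const.mul (contDiffOn_ringInverse_comp (contDiffOn_const.sub contDiffOn_id)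
    fun _ hx => hx)).sub contDiffOn_const).mul contDiffOn_const

end Ring

variable {A : Type*} [CStarAlgebra A]

theorem contDiffOn_star_comp {f : X → A} (hf : ContDiffOn ℝ ∞ f s) :
    ContDiffOn ℝ ∞ (fun x => star (f x)) s :=
  contDiff_star.comp_contDiffOn hf

theorem contDiff_mul_star_self : ContDiff ℝ ∞ fun v : A => v * star v :=
  contDiff_id.mul contDiff_star

theorem contDiff_star_mul_self : ContDiff ℝ ∞ fun v : A => star v * v :=
  contDiff_star.mul contDiff_id

/-- The elements `v` whose target `v v*` and source `v* v` are in the domains of the graph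
coordinates relative to those of `u`. -/
def endDomainOp (u : A) : Set A :=
  {v | v * star v ∈ graphDomainOp (u * star u)} ∩ {v | star v * v ∈ graphDomainOp (star u * u)}

theorem isOpen_endDomainOp (u : A) : IsOpen (endDomainOp u) :=
  ((isOpen_graphDomainOp _).preimage contDiff_mul_star_self.continuous).inter
    ((isOpen_graphDomainOp _).preimage contDiff_star_mul_self.continuous)

theorem contDiffOn_graphCoordOp_mul_star_self (u : A) :
    ContDiffOn ℝ ∞ (fun v => graphCoordOp (u * star u) (v * star v)) (endDomainOp u) :=
  (contDiffOn_graphCoordOp _).comp contDiff_mul_star_self.contDiffOn fun _ hv => hv.1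

theorem contDiffOn_graphCoordOp_star_mul_self (u : A) :
    ContDiffOn ℝ ∞ (fun v => graphCoordOp (star u * u) (star v * v)) (endDomainOp u) :=
  (contDiffOn_graphCoordOp _).comp contDiff_star_mul_self.contDiffOn fun _ hv => hv.2

variable [PartialOrder A] [StarOrderedRing A]

theorem contDiff_graphSection (p : A) : ContDiff ℝ ∞ (graphSection p) :=
  ((contDiff_const.add contDiff_id).mul
    contDiff_sqrt_ringInverse_one_add_star_mul_self).mul contDiff_const

/-- The unitary part of `v` relative to `u`, as a function of an arbitrary element `v` in place
of a partial isometry. -/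
def unitaryPartOp (u v : A) : A :=
  star u * star (graphSection (u * star u) (graphCoordOp (u * star u) (v * star v))) * v *
    graphSection (star u * u) (graphCoordOp (star u * u) (star v * v))

/-- The elements `v` at which the coordinates of the chart of the set of partial isometries at `u`
are defined and smooth. -/
def partialIsometryDomainOp (u : A) : Set A := endDomainOp u ∩ {v | IsUnit (1 + unitaryPartOp u v)}

theorem contDiffOn_unitaryPartOp (u : A) : ContDiffOn ℝ ∞ (unitaryPartOp u) (endDomainOp u) :=
  ((contDiffOn_const.mul (contDiffOn_star_comp ((contDiff_graphSection _).comp_contDiffOn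
    (contDiffOn_graphCoordOp_mul_star_self u)))).mul contDiffOn_id).mul
      ((contDiff_graphSection _).comp_contDiffOn (contDiffOn_graphCoordOp_star_mul_self u))

theorem isOpen_partialIsometryDomainOp (u : A) : IsOpen (partialIsometryDomainOp u) :=
  (contDiffOn_const.add (contDiffOn_unitaryPartOp u)).continuousOn.isOpen_inter_preimage
    (isOpen_endDomainOp u) Units.isOpen

end SmoothFormulas

section GrassmannianSlice

variable {H : Type u} [NormedAddCommGroup H] [InnerProductSpace ℂ H] [CompleteSpace H]
  {p q : Proj H}

theorem mem_graphDomain_iff_mem_graphDomainOp : q ∈ graphDomain p ↔ q.1 ∈ graphDomainOp p.1 := by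
  refine ⟨fun h => ⟨?_, mem_graphDomain_iff_isUnit.1 h⟩, fun h => mem_graphDomain_iff_isUnit.2 h.2⟩
  have hcompr : p.1 * q.1 * p.1 + (1 - p.1) =
      Ring.inverse (1 + star (graphCoord p q) * graphCoord p q) := by
    rw [← IsOffDiag.compression_graphSection_mul_star p.2 (graphCoord_mem p q)]
    nth_rw 1 [← graphProj_graphCoord h]
    rfl
  rw [hcompr]
  exact (isUnit_one_add_star_mul_self _).ringInverse

theorem mem_graphDomain_self (p : Proj H) : p ∈ graphDomain p :=
  mem_graphDomain_iff_exists_isOblique.2 ⟨p.1, p.mul_self, p.mul_self, p.mul_self, p.mul_self⟩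

theorem contDiff_graphSection_mul_star_subtype (p : Proj H) (S : Submodule ℝ (H →L[ℂ] H)) :
    ContDiff ℝ ∞ fun A : S =>
      graphSection p.1 (A : H →L[ℂ] H) * star (graphSection p.1 (A : H →L[ℂ] H)) :=
  (contDiff_mul_star_self.comp (contDiff_graphSection p.1)).comp S.subtypeL.contDiff

/-- The graph charts as charts adapted to the inclusion into the bounded operators. -/
def grassmannianSliceAtlas :
    SliceAtlas (Subtype.val : Proj H → H →L[ℂ] H) (grassmannianAtlas H) where
  chart p :=
    { ambient := H →L[ℂ] H
      ι := (offDiag p).subtypeₗᵢ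
      U := graphDomainOp p.1
      Φ := graphCoordOp p.1
      Ψ := fun A : offDiag p =>
        graphSection p.1 (A : H →L[ℂ] H) * star (graphSection p.1 (A : H →L[ℂ] H))
      injective := Subtype.val_injective
      isOpen_U := isOpen_graphDomainOp p.1
      contDiffOn_Φ := contDiffOn_graphCoordOp p.1
      contDiff_Ψ := contDiff_graphSection_mul_star_subtype p _
      mem_source := fun _ => mem_graphDomain_iff_mem_graphDomainOp
      Φ_apply := fun _ _ => rfl
      Ψ_toFun := fun _ hq => congrArg Subtype.val (graphProj_graphCoord hq)
      surj := fun A => ⟨graphProj p A.1 A.2, graphProj_mem_graphDomain A.2,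
        Subtype.ext (graphCoord_graphProj A.2)⟩ }
  covers p := ⟨p, mem_graphDomain_self p⟩

end GrassmannianSlice

/-! ### The charts of the set of partial isometries -/

section PartialIsometry

variable {H : Type u} [NormedAddCommGroup H] [InnerProductSpace ℂ H] [CompleteSpace H]

namespace PIso

theorem mul_src (v : PIso H) : v.1 * v.src.1 = v.1 := v.mul_star_mul

theorem tgt_mul (v : PIso H) : v.tgt.1 * v.1 = v.1 :=
  (mul_assoc v.1 (star v.1) v.1).trans v.mul_star_mul

theorem star_mul_tgt (v : PIso H) : star v.1 * v.tgt.1 = star v.1 := by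
  simpa only [star_mul, v.tgt.star_eq] using congrArg star v.tgt_mul

theorem src_mul_star (v : PIso H) : v.src.1 * star v.1 = star v.1 := by
  simpa only [star_mul, v.src.star_eq] using congrArg star v.mul_src

theorem isUnitaryInCorner {g : PIso H} {p : Proj H} (hs : g.src = p) (ht : g.tgt = p) :
    IsUnitaryInCorner p.1 g.1 where
  proj_mul := by rw [← ht, g.tgt_mul]
  mul_proj := by rw [← hs, g.mul_src]
  star_mul_self := congrArg Subtype.val hs
  mul_star_self := congrArg Subtype.val ht

/-! For `S` and `T` with the same sources as `u*` and `u`, the formula `g = u* S* v T` gives a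
bijection from the arrows `v` between the targets of `T` and `S` to the unitaries `g` of the
source of `u`, with inverse `v = S u g T*`. -/

variable {u v S T : PIso H}

theorem isUnitaryInCorner_star_mul_mul (hS : S.src = u.tgt) (hT : T.src = u.src)
    (hSv : S.tgt = v.tgt) (hTv : T.tgt = v.src) :
    IsUnitaryInCorner u.src.1 (star u.1 * star S.1 * v.1 * T.1) := by
  let 𝒢 := partialIsometryGroupoid H
  let uS := 𝒢.mul (𝒢.inv u) (𝒢.inv S) (by rw [𝒢.s_inv, 𝒢.t_inv]; exact hS.symm)
  let uSv := 𝒢.mul uS v (by rw [𝒢.s_mul, 𝒢.s_inv]; exact hSv)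
  let g := 𝒢.mul uSv T (by rw [𝒢.s_mul]; exact hTv.symm)
  exact isUnitaryInCorner (g := g) ((𝒢.s_mul _ _ _).trans hT)
    ((𝒢.t_mul uSv T _).trans ((𝒢.t_mul uS v _).trans ((𝒢.t_mul _ _ _).trans (𝒢.t_inv u))))

theorem mul_star_mul_mul_mul_star (hS : S.src = u.tgt) (hSv : S.tgt = v.tgt)
    (hTv : T.tgt = v.src) :
    S.1 * u.1 * (star u.1 * star S.1 * v.1 * T.1) * star T.1 = v.1 := by
  have hu : u.1 * star u.1 = S.src.1 := congrArg Subtype.val hS.symm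
  have hSS : S.1 * star S.1 = v.tgt.1 := congrArg Subtype.val hSv
  have hTT : T.1 * star T.1 = v.src.1 := congrArg Subtype.val hTv
  calc _ = S.1 * (u.1 * star u.1) * star S.1 * (v.1 * (T.1 * star T.1)) := by
        simp only [mul_assoc]
    _ = v.1 := by rw [hu, S.mul_src, hSS, hTT, v.mul_src, v.tgt_mul]

theorem exists_eq_mul_mul_star (hS : S.src = u.tgt) (hT : T.src = u.src) {g : H →L[ℂ] H}
    (hg : IsUnitaryInCorner u.src.1 g) :
    ∃ v : PIso H, v.1 = S.1 * u.1 * g * star T.1 ∧ v.tgt = S.tgt ∧ v.src = T.tgt := by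
  let 𝒢 := partialIsometryGroupoid H
  let g' : PIso H := ⟨g, hg.star_mul_self ▸ u.src.2⟩
  let Su := 𝒢.mul S u hS
  let Sug := 𝒢.mul Su g' ((𝒢.s_mul _ _ _).trans (Subtype.ext hg.mul_star_self.symm))
  let v := 𝒢.mul Sug (𝒢.inv T) <| by
    rw [𝒢.s_mul, 𝒢.t_inv]
    exact (Subtype.ext hg.star_mul_self).trans hT.symm
  exact ⟨v, rfl, (𝒢.t_mul Sug _ _).trans ((𝒢.t_mul Su g' _).trans (𝒢.t_mul S u hS)),
    (𝒢.s_mul _ _ _).trans (𝒢.s_inv T)⟩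

theorem star_mul_mul_mul_star_mul (hS : S.src = u.tgt) (hT : T.src = u.src) {g : H →L[ℂ] H}
    (hg : IsUnitaryInCorner u.src.1 g) :
    star u.1 * star S.1 * (S.1 * u.1 * g * star T.1) * T.1 = g := by
  have hSS : star S.1 * S.1 = u.tgt.1 := congrArg Subtype.val hS
  have hTT : star T.1 * T.1 = u.src.1 := congrArg Subtype.val hT
  calc _ = star u.1 * (star S.1 * S.1) * u.1 * (g * (star T.1 * T.1)) := by
        simp only [mul_assoc]
    _ = u.src.1 * g := by rw [hSS, hTT, hg.mul_proj, u.star_mul_tgt]; rfl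
    _ = g := hg.proj_mul

end PIso

theorem graphPIso_src {p : Proj H} {A : H →L[ℂ] H} (hA : A ∈ offDiag p) :
    (graphPIso p A hA).src = p :=
  Subtype.ext (IsOffDiag.star_graphSection_mul_self p.2 hA)

/-- The inverse of the chart of the set of partial isometries at `u`. -/
def partialIsometryOfCoord (u : PIso H) (A B X : H →L[ℂ] H) : H →L[ℂ] H :=
  graphSection u.tgt.1 A * u.1 * cayleyInv u.src.1 X * star (graphSection u.src.1 B)

variable {u v : PIso H}

theorem isUnitaryInCorner_unitaryPart (ht : v.tgt ∈ graphDomain u.tgt)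
    (hs : v.src ∈ graphDomain u.src) : IsUnitaryInCorner u.src.1 (unitaryPart u v) :=
  PIso.isUnitaryInCorner_star_mul_mul (S := graphPIso _ _ (graphCoord_mem u.tgt v.tgt))
    (T := graphPIso _ _ (graphCoord_mem u.src v.src)) (graphPIso_src _) (graphPIso_src _)
    (graphProj_graphCoord ht) (graphProj_graphCoord hs)

theorem partialIsometryOfCoord_toFun (hv : v ∈ partialIsometryDomain u) :
    partialIsometryOfCoord u (graphCoord u.tgt v.tgt) (graphCoord u.src v.src)
      (cayleyCoord u.src (unitaryPart u v)) = v.1 := by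
  obtain ⟨ht, hs, hu⟩ := hv
  rw [partialIsometryOfCoord, cayleyInv_cayleyCoord (isUnitaryInCorner_unitaryPart ht hs) hu]
  exact PIso.mul_star_mul_mul_mul_star (S := graphPIso _ _ (graphCoord_mem u.tgt v.tgt))
    (T := graphPIso _ _ (graphCoord_mem u.src v.src)) (graphPIso_src _)
    (graphProj_graphCoord ht) (graphProj_graphCoord hs)

theorem exists_partialIsometry_of_coord {A B X : H →L[ℂ] H} (hA : A ∈ offDiag u.tgt)
    (hB : B ∈ offDiag u.src) (hX : X ∈ skewCorner u.src) :
    ∃ v ∈ partialIsometryDomain u, graphCoord u.tgt v.tgt = A ∧ graphCoord u.src v.src = B ∧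
      cayleyCoord u.src (unitaryPart u v) = X := by
  have hg := isUnitaryInCorner_cayleyInv_of_mem hX
  obtain ⟨v, hv, ht, hs⟩ := PIso.exists_eq_mul_mul_star (graphPIso_src hA) (graphPIso_src hB) hg
  replace ht : v.tgt = graphProj u.tgt A hA := ht
  replace hs : v.src = graphProj u.src B hB := hs
  have hAv : graphCoord u.tgt v.tgt = A := by rw [ht, graphCoord_graphProj]
  have hBv : graphCoord u.src v.src = B := by rw [hs, graphCoord_graphProj]
  have hunit : unitaryPart u v = cayleyInv u.src.1 X := by
    rw [unitaryPart, crossSection, crossSection, hAv, hBv, hv]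
    exact PIso.star_mul_mul_mul_star_mul (graphPIso_src hA) (graphPIso_src hB) hg
  refine ⟨v, ⟨?_, ?_, ?_⟩, hAv, hBv, ?_⟩
  · rw [ht]; exact graphProj_mem_graphDomain hA
  · rw [hs]; exact graphProj_mem_graphDomain hB
  · rw [hunit]; exact isUnit_one_add_cayleyInv_of_mem hX
  · rw [hunit, cayleyCoord_cayleyInv hX]

theorem crossSection_eq_graphSection (p q : Proj H) :
    crossSection p q = graphSection p.1 (graphCoord p q) := rfl

theorem unitaryPart_eq (u v : PIso H) : unitaryPart u v = unitaryPartOp u.1 v.1 := by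
  rw [unitaryPart, crossSection_eq_graphSection, crossSection_eq_graphSection]
  rfl

theorem mem_partialIsometryDomain_iff :
    v ∈ partialIsometryDomain u ↔ v.1 ∈ partialIsometryDomainOp u.1 := by
  have ht : v.tgt ∈ graphDomain u.tgt ↔ v.tgt.1 ∈ graphDomainOp u.tgt.1 :=
    mem_graphDomain_iff_mem_graphDomainOp
  have hs : v.src ∈ graphDomain u.src ↔ v.src.1 ∈ graphDomainOp u.src.1 :=
    mem_graphDomain_iff_mem_graphDomainOp
  have hg : IsUnit (1 + unitaryPart u v) ↔ IsUnit (1 + unitaryPartOp u.1 v.1) := by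
    rw [unitaryPart_eq]
  exact ⟨fun h => ⟨⟨ht.1 h.1, hs.1 h.2.1⟩, hg.1 h.2.2⟩,
    fun h => ⟨ht.2 h.1.1, hs.2 h.1.2, hg.2 h.2⟩⟩

theorem graphCoord_self (p : Proj H) : graphCoord p p = 0 := by
  simp only [graphCoord, p.2.one_sub_mul_self, zero_mul]

theorem crossSection_self (p : Proj H) : crossSection p p = p.1 := by
  simp only [crossSection, graphCoord_self, star_zero, zero_mul, add_zero, Ring.inverse_one,
    CFC.sqrt_one, mul_one, p.mul_self]

theorem unitaryPart_self (u : PIso H) : unitaryPart u u = u.src.1 := by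
  rw [unitaryPart, crossSection_self, crossSection_self, u.tgt.star_eq, u.star_mul_tgt, mul_assoc,
    u.mul_src]
  rfl

theorem mem_partialIsometryDomain_self (u : PIso H) : u ∈ partialIsometryDomain u := by
  refine ⟨mem_graphDomain_self _, mem_graphDomain_self _, ?_⟩
  rw [unitaryPart_self, ← u.src.2.isIdempotentElem.eq]
  nth_rw 1 [← u.src.star_eq]
  exact isUnit_one_add_star_mul_self u.src.1

theorem contDiffOn_cayleyCoord (p : Proj H) :
    ContDiffOn ℝ ∞ (cayleyCoord p) {g | IsUnit (1 + g)} := by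
  have hinv : ContDiffOn ℝ ∞ (fun g : H →L[ℂ] H => p.1 * Ring.inverse (1 + g) * p.1)
      {g | IsUnit (1 + g)} :=
    (contDiffOn_const.mul (contDiffOn_ringInverse_comp (contDiffOn_const.add contDiffOn_id)
      fun _ hg => hg)).mul contDiffOn_const
  exact ((contDiffOn_star_comp hinv).mul
    (contDiffOn_id.sub (contDiffOn_star_comp contDiffOn_id))).mul hinv

/-- The coordinates of the chart of the set of partial isometries at `u`, as functions of an
arbitrary operator. -/
def partialIsometryCoordOp (u : PIso H) (v : H →L[ℂ] H) :
    (H →L[ℂ] H) × (H →L[ℂ] H) × (H →L[ℂ] H) :=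
  (graphCoordOp u.tgt.1 (v * star v), graphCoordOp u.src.1 (star v * v),
    cayleyCoord u.src (unitaryPartOp u.1 v))

theorem partialIsometryCoordOp_apply (u v : PIso H) :
    partialIsometryCoordOp u v.1 = (graphCoord u.tgt v.tgt, graphCoord u.src v.src,
      cayleyCoord u.src (unitaryPart u v)) := by
  rw [unitaryPart_eq]
  rfl

theorem contDiffOn_partialIsometryCoordOp (u : PIso H) :
    ContDiffOn ℝ ∞ (partialIsometryCoordOp u) (partialIsometryDomainOp u.1) := by
  have hsub : partialIsometryDomainOp u.1 ⊆ endDomainOp u.1 := Set.inter_subset_left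
  exact ((contDiffOn_graphCoordOp_mul_star_self u.1).mono hsub).prodMk
    (((contDiffOn_graphCoordOp_star_mul_self u.1).mono hsub).prodMk
      ((contDiffOn_cayleyCoord u.src).comp ((contDiffOn_unitaryPartOp u.1).mono hsub)
        fun _ hv => hv.2))

theorem contDiff_partialIsometryOfCoord (u : PIso H) (S T : Submodule ℝ (H →L[ℂ] H)) :
    ContDiff ℝ ∞ fun z : S × T × skewCorner u.src =>
      partialIsometryOfCoord u z.1 z.2.1 z.2.2 := by
  have htgt : ContDiff ℝ ∞ fun z : S × T × skewCorner u.src =>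
      graphSection u.tgt.1 (z.1 : H →L[ℂ] H) :=
    (contDiff_graphSection _).comp (S.subtypeL.contDiff.comp contDiff_fst)
  have hsrc : ContDiff ℝ ∞ fun z : S × T × skewCorner u.src =>
      star (graphSection u.src.1 (z.2.1 : H →L[ℂ] H)) :=
    contDiff_star.comp ((contDiff_graphSection _).comp
      (T.subtypeL.contDiff.comp (contDiff_fst.comp contDiff_snd)))
  have hunit : ContDiff ℝ ∞ fun z : S × T × skewCorner u.src =>
      cayleyInv u.src.1 (z.2.2 : H →L[ℂ] H) :=
    (contDiffOn_cayleyInv u.src.1).comp_contDiff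
      ((skewCorner u.src).subtypeL.contDiff.comp (contDiff_snd.comp contDiff_snd))
      fun z => isUnit_one_sub_of_star_eq_neg z.2.2.2.1
  exact ((htgt.mul contDiff_const).mul hunit).mul hsrc

/-- The inclusion of a product of three subspaces. -/
def subtypeProd₃ {𝕜 E₁ E₂ E₃ : Type*} [Ring 𝕜] [SeminormedAddCommGroup E₁] [Module 𝕜 E₁]
    [SeminormedAddCommGroup E₂] [Module 𝕜 E₂] [SeminormedAddCommGroup E₃] [Module 𝕜 E₃]
    (S₁ : Submodule 𝕜 E₁) (S₂ : Submodule 𝕜 E₂) (S₃ : Submodule 𝕜 E₃) :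
    (S₁ × S₂ × S₃) →ₗᵢ[𝕜] E₁ × E₂ × E₃ where
  toLinearMap := S₁.subtype.prodMap (S₂.subtype.prodMap S₃.subtype)
  norm_map' _ := rfl

/-- The charts of the set of partial isometries as charts adapted to the inclusion into the
bounded operators. -/
def partialIsometrySliceAtlas :
    SliceAtlas (Subtype.val : PIso H → H →L[ℂ] H) (partialIsometryAtlas H) where
  chart u :=
    { ambient := (H →L[ℂ] H) × (H →L[ℂ] H) × (H →L[ℂ] H)
      ι := subtypeProd₃ (offDiag u.tgt) (offDiag u.src) (skewCorner u.src)
      U := partialIsometryDomainOp u.1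
      Φ := partialIsometryCoordOp u
      Ψ := fun z : offDiag u.tgt × offDiag u.src × skewCorner u.src =>
        partialIsometryOfCoord u z.1 z.2.1 z.2.2
      injective := Subtype.val_injective
      isOpen_U := isOpen_partialIsometryDomainOp u.1
      contDiffOn_Φ := contDiffOn_partialIsometryCoordOp u
      contDiff_Ψ := contDiff_partialIsometryOfCoord u _ _
      mem_source := fun _ => mem_partialIsometryDomain_iff
      Φ_apply := fun v _ => partialIsometryCoordOp_apply u v
      Ψ_toFun := fun _ hv => partialIsometryOfCoord_toFun hv
      surj := fun ⟨A, B, X⟩ => by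
        obtain ⟨v, hv, hA, hB, hX⟩ := exists_partialIsometry_of_coord A.2 B.2 X.2
        exact ⟨v, hv, Prod.ext (Subtype.ext hA) (Prod.ext (Subtype.ext hB) (Subtype.ext hX))⟩ }
  covers u := ⟨u, mem_partialIsometryDomain_self u⟩

end PartialIsometry

section PartialIsometryGroupoid

variable {H : Type u} [NormedAddCommGroup H] [InnerProductSpace ℂ H] [CompleteSpace H]

theorem graphCoordOp_mem (p : Proj H) (q : H →L[ℂ] H) : graphCoordOp p.1 q ∈ offDiag p := by
  refine IsOffDiag.of_proj_mul_of_mul_proj ?_ ?_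
  · simp only [graphCoordOp, ← mul_assoc, p.2.mul_one_sub_self, zero_mul]
  · rw [graphCoordOp, mul_assoc, p.mul_self]

theorem isBanachLieGroupoid_partialIsometryGroupoid :
    (partialIsometryGroupoid H).IsBanachLieGroupoid
      (partialIsometryAtlas H) (grassmannianAtlas H) where
  manifold_arrows := partialIsometrySliceAtlas.isBanachManifold
  manifold_objects := grassmannianSliceAtlas.isBanachManifold
  surjective_s p := ⟨_, (partialIsometryGroupoid H).s_unit p⟩
  surjective_t p := ⟨_, (partialIsometryGroupoid H).t_unit p⟩
  submersion_s := partialIsometrySliceAtlas.isSubmersion grassmannianSliceAtlas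
    ⟨_, contDiff_star_mul_self, fun _ => rfl⟩ fun u =>
      ⟨u.src, .fst ℝ (offDiag u.src) (skewCorner u.src) ∘L .snd ℝ (offDiag u.tgt) _,
        .comp .fst .snd, fun _ hv => hv.2.1, fun _ _ => rfl⟩
  submersion_t := partialIsometrySliceAtlas.isSubmersion grassmannianSliceAtlas
    ⟨_, contDiff_mul_star_self, fun _ => rfl⟩ fun u =>
      ⟨u.tgt, .fst ℝ (offDiag u.tgt) _, .fst, fun _ hv => hv.1, fun _ _ => rfl⟩
  smooth_mul := partialIsometrySliceAtlas.isSmoothMul _ (fun _ _ _ => rfl) fun _ _ _ _ =>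
    ⟨(⟨_, graphCoordOp_mem _ _⟩, ⟨_, graphCoordOp_mem _ _⟩, ⟨_, cayleyCoord_mem _ _⟩), rfl⟩
  embedding_unit := partialIsometrySliceAtlas.isEmbedding_of_comp_eq grassmannianSliceAtlas rfl
  bijective_inv := Function.Involutive.bijective fun v => Subtype.ext (star_star v.1)
  smooth_inv := partialIsometrySliceAtlas.isSmoothMap partialIsometrySliceAtlas
    ⟨_, contDiff_star, fun _ => rfl⟩

end PartialIsometryGroupoid

/-! ### Compact perturbations of Fredholm operators -/

section Fredholm

open scoped LinearMap.FiniteRangeSetoid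

variable {𝕜 : Type*} [RCLike 𝕜] {D E F : Type*} [NormedAddCommGroup D] [NormedSpace 𝕜 D]
  [NormedAddCommGroup E] [NormedSpace 𝕜 E] [NormedAddCommGroup F]

theorem isFredholm_continuousLinearEquiv (e : D ≃L[𝕜] E) : (e : D →L[𝕜] E).IsFredholm :=
  .of_isQuasiInverse (v := (e.symm : E →L[𝕜] D)) e.toLinearEquiv.isQuasiInverse

theorem isFredholm_comp_continuousLinearEquiv [NormedSpace 𝕜 F] {T : E →L[𝕜] F}
    (hT : T.IsFredholm) (e : D ≃L[𝕜] E) : (T ∘L (e : D →L[𝕜] E)).IsFredholm := by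
  obtain ⟨S, hS⟩ := hT.exists_isQuasiInverse
  exact .of_isQuasiInverse (v := (e.symm : E →L[𝕜] D) ∘L S)
    (e.toLinearEquiv.isQuasiInverse.comp hS)

variable [InnerProductSpace 𝕜 F]

theorem exists_hasNoetherianRange_norm_sub_lt {K : E →L[𝕜] F} (hK : IsCompactOperator K) {ε : ℝ}
    (hε : 0 < ε) : ∃ G : E →L[𝕜] F, (G : E →ₗ[𝕜] F).HasNoetherianRange ∧ ‖K - G‖ < ε := by
  obtain ⟨C, hC, hKC⟩ := hK.image_closedBall_subset_compact (f := (K : E →ₗ[𝕜] F)) 1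
  obtain ⟨t, -, htf, ht⟩ := hC.finite_cover_balls (half_pos hε)
  let V := Submodule.span 𝕜 t
  have : FiniteDimensional 𝕜 V := .span_of_finite 𝕜 htf
  refine ⟨V.starProjection ∘L K, ?_, ?_⟩
  · have hV : (V.starProjection : F →ₗ[𝕜] F).HasNoetherianRange := by
      rw [LinearMap.hasNoetherianRange_iff_range, V.range_starProjection]
      infer_instance
    exact hV.comp_right _
  · refine (ContinuousLinearMap.opNorm_le_of_unit_norm (𝕜 := 𝕜) (half_pos hε).le
      fun x hx => ?_).trans_lt (half_lt_self hε)
    obtain ⟨y, hy, hxy⟩ := Set.mem_iUnion₂.1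
      (ht (hKC ⟨x, mem_closedBall_zero_iff.2 hx.le, rfl⟩))
    calc ‖K x - V.starProjection (K x)‖ = ⨅ z : V, ‖K x - z‖ := V.starProjection_minimal (K x)
      _ ≤ ‖K x - y‖ := ciInf_le ⟨0, Set.forall_mem_range.2 fun _ => norm_nonneg _⟩
          (⟨y, Submodule.subset_span hy⟩ : V)
      _ ≤ ε / 2 := (mem_ball_iff_norm.1 hxy).le

/-- Modulo operators of finite rank, `T + K` is `T` followed by an invertible operator close to
the identity. -/
theorem isFredholm_add_isCompactOperator [CompleteSpace F] {T K : E →L[𝕜] F} (hT : T.IsFredholm)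
    (hK : IsCompactOperator K) : (T + K).IsFredholm := by
  obtain ⟨S, hS⟩ := hT.exists_isQuasiInverse
  obtain ⟨G, hG, hKG⟩ := exists_hasNoetherianRange_norm_sub_lt hK
    (inv_pos.2 (by positivity : 0 < ‖S‖ + 1))
  let L := K - G
  have hLS : ‖-(L ∘L S)‖ < 1 := by
    rw [norm_neg]
    calc ‖L ∘L S‖ ≤ ‖L‖ * ‖S‖ := L.opNorm_comp_le S
      _ ≤ (‖S‖ + 1)⁻¹ * ‖S‖ := by gcongr
      _ < 1 := by rw [inv_mul_lt_one₀ (by positivity)]; exact lt_add_one _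
  let e : F ≃L[𝕜] F := ContinuousLinearEquiv.unitsEquiv 𝕜 F (Units.oneSub _ hLS)
  have he (y : F) : e y = y + L (S y) := sub_neg_eq_add _ _
  have hequiv : ((T + K : E →L[𝕜] F) : E →ₗ[𝕜] F) ≈ (e : F →ₗ[𝕜] F) ∘ₗ (T : E →ₗ[𝕜] F) := by
    rw [LinearMap.FiniteRangeSetoid.equiv_iff_hasNoetherianRange]
    have hdiff : ((T + K : E →L[𝕜] F) : E →ₗ[𝕜] F) - (e : F →ₗ[𝕜] F) ∘ₗ (T : E →ₗ[𝕜] F) =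
        (G : E →ₗ[𝕜] F) - (L : E →ₗ[𝕜] F) ∘ₗ ((S : F →ₗ[𝕜] E) ∘ₗ (T : E →ₗ[𝕜] F) - .id) := by
      ext x
      change T x + K x - e (T x) = G x - L (S (T x) - x)
      rw [he, map_sub, show L x = K x - G x from rfl]
      abel
    rw [hdiff]
    exact hG.sub ((LinearMap.FiniteRangeSetoid.equiv_iff_hasNoetherianRange.1 hS.1).comp_left _)
  exact .of_isQuasiInverse (v := S ∘L (e.symm : F →L[𝕜] F))
    ((hS.comp e.toLinearEquiv.isQuasiInverse).congr (Setoid.refl _) hequiv)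

end Fredholm

/-! ### The restricted Grassmannian and its groupoid -/

section RestrictedGrassmannian

/-- The isomorphism of the range of `q` with the range of `p` given by `p`, with inverse given by
the oblique projection `Q`. -/
def IsOblique.rangeEquiv {𝕜 E : Type*} [Ring 𝕜] [TopologicalSpace E] [AddCommGroup E]
    [IsTopologicalAddGroup E] [Module 𝕜 E] {p q Q : E →L[𝕜] E} (hp : IsIdempotentElem p)
    (h : IsOblique p q Q) :
    LinearMap.range (q : E →ₗ[𝕜] E) ≃L[𝕜] LinearMap.range (p : E →ₗ[𝕜] E) :=
  .equivOfInverse (p.rangeRestrict ∘L Submodule.subtypeL _)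
    (Q.codRestrict _ (fun x => ⟨Q x, DFunLike.congr_fun h.mul_left x⟩) ∘L Submodule.subtypeL _)
    (by
      rintro ⟨_, x, rfl⟩
      have hQ : Q * p * q = q := by rw [h.mul_proj, h.mul_right]
      exact Subtype.ext (DFunLike.congr_fun hQ x))
    (by
      rintro ⟨_, x, rfl⟩
      have hQ : p * Q * p = p := by rw [h.proj_mul, hp.eq]
      exact Subtype.ext (DFunLike.congr_fun hQ x))

theorem isCompactOperator_mul_mul_of_mul_eq {𝕜 E : Type*} [NontriviallyNormedField 𝕜]
    [NormedAddCommGroup E] [NormedSpace 𝕜 E] {a t u : E →L[𝕜] E}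
    (h : IsCompactOperator (a * t : E →L[𝕜] E)) (htu : t * u = u) (b : E →L[𝕜] E) :
    IsCompactOperator (a * (u * b) : E →L[𝕜] E) := by
  have hfactor : a * (u * b) = a * t * (u * b) := by rw [mul_assoc, ← mul_assoc t, htu]
  rw [hfactor]
  exact h.comp_clm (u * b)

variable {H : Type u} [NormedAddCommGroup H] [InnerProductSpace ℂ H] [CompleteSpace H]

theorem graphCoordOp_mem_compactOffDiag {p : Proj H} {q : H →L[ℂ] H}
    (h : IsCompactOperator ((1 - p.1) * q : H →L[ℂ] H)) :
    graphCoordOp p.1 q ∈ compactOffDiag p := by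
  refine ⟨graphCoordOp_mem p q, ?_⟩
  have hfactor : graphCoordOp p.1 q = ((1 - p.1) * q) *
      (p.1 * Ring.inverse (p.1 * q * p.1 + (1 - p.1)) * p.1) := by
    simp only [graphCoordOp, mul_assoc]
  rw [hfactor]
  exact h.comp_clm _

variable {Hp : Submodule ℂ H} [Hp.HasOrthogonalProjection]

theorem graphProj_mem_resGrassmannian {p : Proj H} (hp : p ∈ resGrassmannian Hp) {A : H →L[ℂ] H}
    (hA : A ∈ compactOffDiag p) : graphProj p A hA.1 ∈ resGrassmannian Hp := by
  have hQ := isOblique_graphProj hA.1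
  generalize graphProj p A hA.1 = q at hQ
  have : CompleteSpace Hp := by rw [← Hp.orthogonal_orthogonal]; infer_instance
  have hAc : IsCompactOperator A := hA.2
  let W := LinearMap.range (p.1 : H →ₗ[ℂ] H)
  let V := LinearMap.range (q.1 : H →ₗ[ℂ] H)
  let e : V ≃L[ℂ] W := hQ.rangeEquiv p.mul_self
  have hgraph : V.subtypeL = (W.subtypeL + A ∘L W.subtypeL) ∘L (e : V →L[ℂ] W) := by
    ext x
    obtain ⟨y, rfl⟩ := e.symm.surjective x
    change (e.symm y : H) = e (e.symm y) + A (e (e.symm y))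
    rw [e.apply_symm_apply]
    obtain ⟨_, y, rfl⟩ := y
    exact congrArg (· + A (p.1 y)) (DFunLike.congr_fun p.mul_self y)
  have hcomp {F : Type u} [NormedAddCommGroup F] [NormedSpace ℂ F] (P : H →L[ℂ] F) :
      P ∘L V.subtypeL = (P ∘L W.subtypeL + P ∘L A ∘L W.subtypeL) ∘L (e : V →L[ℂ] W) := by
    rw [hgraph, ← P.comp_assoc, P.comp_add]
  refine ⟨?_, ?_⟩ <;> rw [hcomp]
  · exact isFredholm_comp_continuousLinearEquiv (isFredholm_add_isCompactOperator hp.1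
      ((hAc.comp_clm W.subtypeL).clm_comp Hp.orthogonalProjectionOnto)) e
  · exact (hp.2.add ((hAc.comp_clm W.subtypeL).clm_comp Hpᗮ.orthogonalProjectionOnto)).comp_clm _

variable (Hp)

/-- The charts of the restricted Grassmannian as charts adapted to the inclusion into the bounded
operators. -/
def resGrassmannianSliceAtlas :
    SliceAtlas (fun q : {p // p ∈ resGrassmannian Hp} => q.1.1) (resGrassmannianAtlas Hp) where
  chart p :=
    { ambient := H →L[ℂ] H
      ι := (compactOffDiag p.1).subtypeₗᵢ
      U := graphDomainOp p.1.1
      Φ := graphCoordOp p.1.1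
      Ψ := fun A : compactOffDiag p.1 =>
        graphSection p.1.1 (A : H →L[ℂ] H) * star (graphSection p.1.1 (A : H →L[ℂ] H))
      injective := Subtype.val_injective.comp Subtype.val_injective
      isOpen_U := isOpen_graphDomainOp p.1.1
      contDiffOn_Φ := contDiffOn_graphCoordOp p.1.1
      contDiff_Ψ := contDiff_graphSection_mul_star_subtype p.1 _
      mem_source := fun _ => mem_graphDomain_iff_mem_graphDomainOp
      Φ_apply := fun _ _ => rfl
      Ψ_toFun := fun _ hq => congrArg Subtype.val (graphProj_graphCoord hq)
      surj := fun A => ⟨⟨graphProj p.1 A.1 A.2.1, graphProj_mem_resGrassmannian p.2 A.2⟩,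
        graphProj_mem_graphDomain A.2.1, Subtype.ext (graphCoord_graphProj A.2.1)⟩ }
  covers p := ⟨p, mem_graphDomain_self p.1⟩

variable {Hp}

theorem mem_resGrassmannian_of_graphCoord_mem {p q : Proj H} (hp : p ∈ resGrassmannian Hp)
    (hq : q ∈ graphDomain p) (h : graphCoord p q ∈ compactOffDiag p) : q ∈ resGrassmannian Hp :=
  graphProj_graphCoord hq ▸ graphProj_mem_resGrassmannian hp h

theorem mem_resPartialIsometryAtlas_source_iff {u v : ResPIso Hp} :
    v ∈ (resPartialIsometryAtlas Hp u).source ↔ v.1 ∈ partialIsometryDomain u.1 := Iff.rfl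

theorem resPartialIsometryAtlas_toFun_eq {u v : ResPIso Hp} {A : compactOffDiag u.1.tgt}
    {B : compactOffDiag u.1.src} {X : skewCorner u.1.src}
    (hA : graphCoord u.1.tgt v.1.tgt = A) (hB : graphCoord u.1.src v.1.src = B)
    (hX : cayleyCoord u.1.src (unitaryPart u.1 v.1) = X) :
    (resPartialIsometryAtlas Hp u).toFun v = (A, B, X) :=
  Prod.ext (Subtype.ext hA) (Prod.ext (Subtype.ext hB) (Subtype.ext hX))

theorem exists_resPartialIsometry_of_coord (u : ResPIso Hp)
    (z : compactOffDiag u.1.tgt × compactOffDiag u.1.src × skewCorner u.1.src) :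
    ∃ v ∈ (resPartialIsometryAtlas Hp u).source, (resPartialIsometryAtlas Hp u).toFun v = z := by
  obtain ⟨A, B, X⟩ := z
  obtain ⟨v, hv, hA, hB, hX⟩ := exists_partialIsometry_of_coord A.2.1 B.2.1 X.2
  have ht : v.tgt ∈ resGrassmannian Hp :=
    mem_resGrassmannian_of_graphCoord_mem u.2.2 hv.1 (hA ▸ A.2)
  have hs : v.src ∈ resGrassmannian Hp :=
    mem_resGrassmannian_of_graphCoord_mem u.2.1 hv.2.1 (hB ▸ B.2)
  exact ⟨⟨v, hs, ht⟩, mem_resPartialIsometryAtlas_source_iff.2 hv,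
    resPartialIsometryAtlas_toFun_eq hA hB hX⟩

variable (Hp)

/-- The charts of the restricted groupoid as charts adapted to the inclusion into the bounded
operators. -/
def resPartialIsometrySliceAtlas :
    SliceAtlas (fun v : ResPIso Hp => v.1.1) (resPartialIsometryAtlas Hp) where
  chart u :=
    { ambient := (H →L[ℂ] H) × (H →L[ℂ] H) × (H →L[ℂ] H)
      ι := subtypeProd₃ (compactOffDiag u.1.tgt) (compactOffDiag u.1.src) (skewCorner u.1.src)
      U := partialIsometryDomainOp u.1.1
      Φ := partialIsometryCoordOp u.1
      Ψ := fun z : compactOffDiag u.1.tgt × compactOffDiag u.1.src × skewCorner u.1.src =>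
        partialIsometryOfCoord u.1 z.1 z.2.1 z.2.2
      injective := Subtype.val_injective.comp Subtype.val_injective
      isOpen_U := isOpen_partialIsometryDomainOp u.1.1
      contDiffOn_Φ := contDiffOn_partialIsometryCoordOp u.1
      contDiff_Ψ := contDiff_partialIsometryOfCoord u.1 _ _
      mem_source := fun v => mem_partialIsometryDomain_iff (u := u.1) (v := v.1)
      Φ_apply := fun v _ => partialIsometryCoordOp_apply u.1 v.1
      Ψ_toFun := fun _ hv => partialIsometryOfCoord_toFun hv
      surj := exists_resPartialIsometry_of_coord u }
  covers u := ⟨u, mem_partialIsometryDomain_self u.1⟩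

variable {Hp}

/-- The factors `g` and `h` need not be composable. -/
theorem partialIsometryCoordOp_mul_mem_range (g h k : ResPIso Hp) :
    partialIsometryCoordOp k.1 (g.1.1 * h.1.1) ∈
      Set.range (subtypeProd₃ (compactOffDiag k.1.tgt) (compactOffDiag k.1.src)
        (skewCorner k.1.src)) := by
  have htgt := isCompactOperator_mul_mul_of_mul_eq (isCompactOperator_one_sub_mul k.2.2 g.2.2)
    g.1.tgt_mul (h.1.1 * star (g.1.1 * h.1.1))
  have hsrc := isCompactOperator_mul_mul_of_mul_eq (isCompactOperator_one_sub_mul k.2.1 h.2.1)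
    h.1.src_mul_star (star g.1.1 * (g.1.1 * h.1.1))
  rw [← mul_assoc g.1.1] at htgt
  rw [← mul_assoc (star h.1.1), ← star_mul] at hsrc
  exact ⟨(⟨_, graphCoordOp_mem_compactOffDiag htgt⟩, ⟨_, graphCoordOp_mem_compactOffDiag hsrc⟩,
    ⟨_, cayleyCoord_mem _ _⟩), rfl⟩

theorem isBanachLieGroupoid_resPartialIsometryGroupoid :
    (resPartialIsometryGroupoid Hp).IsBanachLieGroupoid
      (resPartialIsometryAtlas Hp) (resGrassmannianAtlas Hp) where
  manifold_arrows := (resPartialIsometrySliceAtlas Hp).isBanachManifold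
  manifold_objects := (resGrassmannianSliceAtlas Hp).isBanachManifold
  surjective_s p := ⟨_, (resPartialIsometryGroupoid Hp).s_unit p⟩
  surjective_t p := ⟨_, (resPartialIsometryGroupoid Hp).t_unit p⟩
  submersion_s := (resPartialIsometrySliceAtlas Hp).isSubmersion (resGrassmannianSliceAtlas Hp)
    ⟨_, contDiff_star_mul_self, fun _ => rfl⟩ fun u =>
      ⟨⟨u.1.src, u.2.1⟩, .fst ℝ (compactOffDiag u.1.src) (skewCorner u.1.src) ∘L
        .snd ℝ (compactOffDiag u.1.tgt) _, .comp .fst .snd, fun _ hv => hv.2.1, fun _ _ => rfl⟩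
  submersion_t := (resPartialIsometrySliceAtlas Hp).isSubmersion (resGrassmannianSliceAtlas Hp)
    ⟨_, contDiff_mul_star_self, fun _ => rfl⟩ fun u =>
      ⟨⟨u.1.tgt, u.2.2⟩, .fst ℝ (compactOffDiag u.1.tgt) _, .fst, fun _ hv => hv.1,
        fun _ _ => rfl⟩
  smooth_mul := (resPartialIsometrySliceAtlas Hp).isSmoothMul _ (fun _ _ _ => rfl)
    fun g h k _ => partialIsometryCoordOp_mul_mem_range g h k
  embedding_unit :=
    (resPartialIsometrySliceAtlas Hp).isEmbedding_of_comp_eq (resGrassmannianSliceAtlas Hp) rfl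
  bijective_inv := Function.Involutive.bijective fun v =>
    Subtype.ext (Subtype.ext (star_star v.1.1))
  smooth_inv := (resPartialIsometrySliceAtlas Hp).isSmoothMap (resPartialIsometrySliceAtlas Hp)
    ⟨_, contDiff_star, fun _ => rfl⟩

theorem isHom_resPartialIsometryGroupoid :
    (resPartialIsometryGroupoid Hp).IsHom (partialIsometryGroupoid H)
      Subtype.val Subtype.val where
  map_s _ := rfl
  map_t _ := rfl
  map_unit _ := rfl
  map_inv _ := rfl
  map_mul _ _ _ _ := rfl

/-- The inclusion of the compact into the bounded operators. -/
def compactOffDiagInclusion (p : Proj H) : compactOffDiag p →ₗᵢ[ℝ] offDiag p where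
  toLinearMap := Submodule.inclusion inf_le_left
  norm_map' _ := rfl

/-- The inclusion of the model spaces of the restricted groupoid. -/
def resModelInclusion (p q : Proj H) : (compactOffDiag p × compactOffDiag q × skewCorner q) →ₗᵢ[ℝ]
    (offDiag p × offDiag q × skewCorner q) where
  toLinearMap := (compactOffDiagInclusion p).toLinearMap.prodMap
    ((compactOffDiagInclusion q).toLinearMap.prodMap .id)
  norm_map' _ := rfl

theorem isLinearInCharts_resGrassmannian (p : {p // p ∈ resGrassmannian Hp}) :
    IsLinearInCharts (resGrassmannianAtlas Hp p) (grassmannianAtlas H p.1) Subtype.val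
      (compactOffDiagInclusion p.1).toContinuousLinearMap where
  mapsTo _ hq := hq
  toFun_apply _ _ := rfl

theorem isLinearInCharts_resPartialIsometry (u : ResPIso Hp) :
    IsLinearInCharts (resPartialIsometryAtlas Hp u) (partialIsometryAtlas H u.1) Subtype.val
      (resModelInclusion u.1.tgt u.1.src).toContinuousLinearMap where
  mapsTo _ hv := hv
  toFun_apply _ _ := rfl

theorem isImmersedSubmanifold_resGrassmannian :
    IsImmersedSubmanifold (resGrassmannianAtlas Hp) (grassmannianAtlas H) Subtype.val :=
  (resGrassmannianSliceAtlas Hp).isImmersedSubmanifold grassmannianSliceAtlas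
    Subtype.val_injective ⟨_, contDiff_id, fun _ => rfl⟩ fun p =>
      ⟨_, _, isLinearInCharts_resGrassmannian p⟩

theorem isImmersedSubmanifold_resPartialIsometry :
    IsImmersedSubmanifold (resPartialIsometryAtlas Hp) (partialIsometryAtlas H) Subtype.val :=
  (resPartialIsometrySliceAtlas Hp).isImmersedSubmanifold partialIsometrySliceAtlas
    Subtype.val_injective ⟨_, contDiff_id, fun _ => rfl⟩ fun u =>
      ⟨_, _, isLinearInCharts_resPartialIsometry u⟩

end RestrictedGrassmannian

/-! ### The compact operators are not complemented -/

section DiagonalOperators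

open scoped ENNReal

variable {𝕜 α κ : Type*} [RCLike 𝕜]

/-- The sets of codes of the initial segments of a 0-1 sequence: two different sequences have only
finitely many initial segments in common. -/
theorem exists_infinite_pairwise_finite_inter : ∃ A : (ℕ → Bool) → Set ℕ,
    (∀ x, (A x).Infinite) ∧ Pairwise fun x y => (A x ∩ A y).Finite := by
  let code (x : ℕ → Bool) (n : ℕ) : ℕ := Encodable.encode ((List.range n).map x)
  have hcode {x y : ℕ → Bool} {n m : ℕ} (h : code x n = code y m) : n = m ∧ ∀ i < n, x i = y i := by
    have hlist : (List.range n).map x = (List.range m).map y := Encodable.encode_injective h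
    obtain rfl : n = m := by simpa using congrArg List.length hlist
    exact ⟨rfl, fun i hi => List.map_inj_left.1 hlist i (List.mem_range.2 hi)⟩
  refine ⟨fun x => Set.range (code x),
    fun x => Set.infinite_range_of_injective fun n m h => (hcode h).1, fun x y hxy => ?_⟩
  obtain ⟨i, hi⟩ := Function.ne_iff.1 hxy
  refine ((Set.finite_Iic i).image (code x)).subset ?_
  rintro _ ⟨⟨n, rfl⟩, ⟨m, hm⟩⟩
  exact ⟨n, Set.mem_Iic.2 (not_lt.1 fun hin => hi ((hcode hm.symm).2 i hin)), rfl⟩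

variable (𝕜) in
/-- The indicator function of a set, as an element of `ℓ^∞`. -/
def boundedIndicator (S : Set α) : lp (fun _ : α => 𝕜) ∞ :=
  ⟨S.indicator 1, memℓp_infty ⟨1, Set.forall_mem_range.2 fun i =>
    (norm_indicator_le_norm_self 1 i).trans_eq norm_one⟩⟩

theorem boundedIndicator_apply_of_mem {S : Set α} {i : α} (hi : i ∈ S) :
    boundedIndicator 𝕜 S i = 1 := Set.indicator_of_mem hi _

theorem boundedIndicator_apply_of_notMem {S : Set α} {i : α} (hi : i ∉ S) :
    boundedIndicator 𝕜 S i = 0 := Set.indicator_of_notMem hi _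

theorem norm_sum_smul_boundedIndicator_le_one {B : κ → Set α} {F : Finset κ}
    (hB : (F : Set κ).PairwiseDisjoint B) {c : κ → ℝ} (hc : ∀ x, |c x| ≤ 1) :
    ‖∑ x ∈ F, c x • boundedIndicator 𝕜 (B x)‖ ≤ 1 := by
  classical
  refine lp.norm_le_of_forall_le zero_le_one fun i => ?_
  rw [lp.coeFn_sum, Finset.sum_apply]
  have hterm : ∀ x ∈ F, ‖(c x • boundedIndicator 𝕜 (B x)) i‖ ≤ if i ∈ B x then 1 else 0 := by
    intro x _
    rw [lp.coeFn_smul, Pi.smul_apply, norm_smul, Real.norm_eq_abs]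
    split_ifs with hi
    · rw [boundedIndicator_apply_of_mem hi, norm_one, mul_one]
      exact hc x
    · rw [boundedIndicator_apply_of_notMem hi, norm_zero, mul_zero]
  have hcard : (F.filter fun x => i ∈ B x).card ≤ 1 := by
    refine Finset.card_le_one.2 fun x hx y hy => ?_
    rw [Finset.mem_filter] at hx hy
    exact hB.elim_set hx.1 hy.1 i hx.2 hy.2
  calc _ ≤ ∑ x ∈ F, if i ∈ B x then (1 : ℝ) else 0 := norm_sum_le_of_le F hterm
    _ = (F.filter fun x => i ∈ B x).card := Finset.sum_boole _ _
    _ ≤ 1 := mod_cast hcard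

theorem sum_abs_apply_boundedIndicator_le {B : κ → Set α} {F : Finset κ}
    (hB : (F : Set κ).PairwiseDisjoint B) (φ : lp (fun _ : α => 𝕜) ∞ →L[ℝ] ℝ) :
    ∑ x ∈ F, |φ (boundedIndicator 𝕜 (B x))| ≤ ‖φ‖ := by
  let s (x : κ) : ℝ := SignType.sign (φ (boundedIndicator 𝕜 (B x)))
  have hs (x : κ) : |s x| ≤ 1 := by
    rcases lt_trichotomy (φ (boundedIndicator 𝕜 (B x))) 0 with h | h | h <;> simp [s, h]
  calc ∑ x ∈ F, |φ (boundedIndicator 𝕜 (B x))|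
      = φ (∑ x ∈ F, s x • boundedIndicator 𝕜 (B x)) := by
        simp only [map_sum, map_smul, smul_eq_mul, s, sign_mul_self]
    _ ≤ ‖φ‖ * ‖∑ x ∈ F, s x • boundedIndicator 𝕜 (B x)‖ :=
        (Real.le_norm_self _).trans (φ.le_opNorm _)
    _ ≤ ‖φ‖ := mul_le_of_le_one_right (norm_nonneg _)
        (norm_sum_smul_boundedIndicator_le_one hB hs)

theorem apply_boundedIndicator_diff {Y : Type*} [NormedAddCommGroup Y] [NormedSpace ℝ Y]
    {φ : lp (fun _ : α => 𝕜) ∞ →L[ℝ] Y}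
    (hφ : ∀ a : lp (fun _ : α => 𝕜) ∞, (Function.support a).Finite → φ a = 0) (S : Set α)
    {G : Set α} (hG : G.Finite) :
    φ (boundedIndicator 𝕜 (S \ G)) = φ (boundedIndicator 𝕜 S) := by
  rw [← sub_eq_zero, ← map_sub]
  refine hφ _ (hG.subset fun i hi => ?_)
  contrapose! hi
  rw [Function.notMem_support, lp.coeFn_sub, Pi.sub_apply, sub_eq_zero]
  by_cases hS : i ∈ S
  · rw [boundedIndicator_apply_of_mem hS,
      boundedIndicator_apply_of_mem (Set.mem_sdiff_of_mem hS hi)]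
  · rw [boundedIndicator_apply_of_notMem hS, boundedIndicator_apply_of_notMem fun h => hS h.1]

/-- Removing the finitely many common points makes finitely many members of the family disjoint, so
the values of the functional on the family are summable. -/
theorem countable_setOf_apply_boundedIndicator_ne_zero {A : κ → Set α}
    (hA : Pairwise fun x y => (A x ∩ A y).Finite) {φ : lp (fun _ : α => 𝕜) ∞ →L[ℝ] ℝ}
    (hφ : ∀ a : lp (fun _ : α => 𝕜) ∞, (Function.support a).Finite → φ a = 0) :
    {x | φ (boundedIndicator 𝕜 (A x)) ≠ 0}.Countable := by
  have hs : Summable fun x => |φ (boundedIndicator 𝕜 (A x))| := by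
    refine summable_of_sum_le (c := ‖φ‖) (fun _ => abs_nonneg _) fun F => ?_
    let G : Set α := ⋃ x ∈ F, ⋃ y ∈ F, ⋃ _ : x ≠ y, A x ∩ A y
    have hG : G.Finite := F.finite_toSet.biUnion fun x _ => F.finite_toSet.biUnion fun y _ =>
      Set.finite_iUnion fun hxy => hA hxy
    have hdisj : (F : Set κ).PairwiseDisjoint fun x => A x \ G := fun x hx y hy hxy =>
      Set.disjoint_left.2 fun i hix hiy => hix.2 <| Set.mem_iUnion₂.2 ⟨x, hx,
        Set.mem_iUnion₂.2 ⟨y, hy, Set.mem_iUnion.2 ⟨hxy, hix.1, hiy.1⟩⟩⟩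
    simpa only [apply_boundedIndicator_diff hφ _ hG] using sum_abs_apply_boundedIndicator_le hdisj φ
  exact hs.countable_support.mono fun x hx => abs_ne_zero.2 hx

theorem exists_infinite_apply_boundedIndicator_eq_zero {Y : Type*} [NormedAddCommGroup Y]
    [NormedSpace ℝ Y] [Countable κ] {ψ : κ → Y →L[ℝ] 𝕜} (hψ : ∀ y, (∀ k, ψ k y = 0) → y = 0)
    {Φ : lp (fun _ : ℕ => 𝕜) ∞ →L[ℝ] Y}
    (hΦ : ∀ a : lp (fun _ : ℕ => 𝕜) ∞, (Function.support a).Finite → Φ a = 0) :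
    ∃ S : Set ℕ, S.Infinite ∧ Φ (boundedIndicator 𝕜 S) = 0 := by
  obtain ⟨A, hinf, hfin⟩ := exists_infinite_pairwise_finite_inter
  have hcount (f : 𝕜 →L[ℝ] ℝ) : (⋃ k, {x | f (ψ k (Φ (boundedIndicator 𝕜 (A x)))) ≠ 0}).Countable :=
    Set.countable_iUnion fun k => countable_setOf_apply_boundedIndicator_ne_zero hfin
      (φ := f ∘L ψ k ∘L Φ) fun a ha => by simp [hΦ a ha]
  have : Uncountable (ℕ → Bool) :=
    Cardinal.aleph0_lt_mk_iff.1 (by simpa using Cardinal.aleph0_lt_continuum)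
  obtain ⟨x, hx⟩ := (Set.ne_univ_iff_exists_notMem _).1 fun h => Set.not_countable_univ <|
    h.subst (motive := Set.Countable) ((hcount RCLike.reCLM).union (hcount RCLike.imCLM))
  simp only [Set.mem_union, Set.mem_iUnion, Set.mem_ofPred_eq, not_or, not_exists, not_not] at hx
  exact ⟨A x, hinf x, hψ _ fun k => RCLike.ext ((hx.1 k).trans RCLike.zero_re.symm)
    ((hx.2 k).trans RCLike.zero_im.symm)⟩

variable (𝕜 α) in
/-- The operator on `ℓ²` multiplying each coordinate by the corresponding entry of a bounded
sequence. -/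
def diagonalOp : lp (fun _ : α => 𝕜) ∞ →L[𝕜] lp (fun _ : α => 𝕜) 2 →L[𝕜] lp (fun _ : α => 𝕜) 2 :=
  lp.holderL 2 (fun _ => ContinuousLinearMap.mul 𝕜 𝕜) (K := 1) fun _ => by simp

theorem isCompactOperator_diagonalOp_single [DecidableEq α] (i : α) (c : 𝕜) :
    IsCompactOperator (diagonalOp 𝕜 α (lp.single ∞ i c : lp (fun _ : α => 𝕜) ∞)) := by
  have hfactor : diagonalOp 𝕜 α (lp.single ∞ i c) =
      lp.singleContinuousLinearMap 𝕜 (fun _ => 𝕜) 2 i ∘L (c • lp.evalCLM 𝕜 (fun _ => 𝕜) 2 i) := by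
    ext x j
    change (lp.single ∞ i c : lp (fun _ : α => 𝕜) ∞) j * x j =
      (lp.single 2 i (c * x i) : lp (fun _ : α => 𝕜) 2) j
    rcases eq_or_ne j i with rfl | hj
    · rw [lp.single_apply_self, lp.single_apply_self]
    · rw [lp.single_apply_ne _ _ _ hj, lp.single_apply_ne _ _ _ hj, zero_mul]
  rw [hfactor]
  exact isCompactOperator_of_locallyCompactSpace_rng
    (lp.singleContinuousLinearMap 𝕜 (fun _ => 𝕜) 2 i) |>.comp_clm _

theorem isCompactOperator_diagonalOp_of_finite_support {a : lp (fun _ : α => 𝕜) ∞}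
    (ha : (Function.support a).Finite) : IsCompactOperator (diagonalOp 𝕜 α a) := by
  classical
  have hsum : a = ∑ i ∈ ha.toFinset, lp.single ∞ i (a i) := by
    ext j
    rw [lp.coeFn_sum, Finset.sum_apply]
    simp [lp.single_apply]
  rw [hsum, map_sum]
  exact Submodule.sum_mem (compactOperator (RingHom.id 𝕜) _ _) fun i _ =>
    isCompactOperator_diagonalOp_single i (a i)

/-- The unit vectors indexed by `S` are fixed and have no convergent subsequence. -/
theorem not_isCompactOperator_diagonalOp_boundedIndicator {S : Set α} (hS : S.Infinite) :
    ¬ IsCompactOperator (diagonalOp 𝕜 α (boundedIndicator 𝕜 S)) := by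
  classical
  intro h
  obtain ⟨C, hC, hSC⟩ := h.image_closedBall_subset_compact
    (f := (diagonalOp 𝕜 α (boundedIndicator 𝕜 S)).toLinearMap) 1
  let j := hS.natEmbedding
  let e (n : ℕ) : lp (fun _ : α => 𝕜) 2 := lp.single 2 (j n : α) 1
  have he (n : ℕ) : e n ∈ C := by
    refine hSC ⟨e n, ?_, ?_⟩
    · rw [mem_closedBall_zero_iff, lp.norm_single (by norm_num), norm_one]
    · ext i
      change boundedIndicator 𝕜 S i * e n i = e n i
      rcases eq_or_ne i (j n) with rfl | hi
      · rw [boundedIndicator_apply_of_mem (j n).2, one_mul]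
      · rw [lp.single_apply_ne _ _ _ hi, mul_zero]
  have hdist {n m : ℕ} (hnm : n ≠ m) : 1 ≤ dist (e n) (e m) := by
    rw [dist_eq_norm]
    have hj : (j n : α) ≠ j m := fun h => hnm (j.injective (Subtype.ext h))
    calc (1 : ℝ) = ‖(e n - e m) (j n)‖ := by
          rw [lp.coeFn_sub, Pi.sub_apply, lp.single_apply_self, lp.single_apply_ne _ _ _ hj,
            sub_zero, norm_one]
      _ ≤ ‖e n - e m‖ := lp.norm_apply_le_norm two_ne_zero _ _
  obtain ⟨_, -, θ, hθ, hlim⟩ := hC.isSeqCompact he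
  obtain ⟨N, hN⟩ := Metric.cauchySeq_iff.1 hlim.cauchySeq 1 one_pos
  exact (hN N le_rfl (N + 1) N.le_succ).not_ge (hdist (hθ N.lt_succ_self).ne)

theorem eq_zero_of_forall_apply_single_eq_zero [DecidableEq α]
    {T : lp (fun _ : α => 𝕜) 2 →L[𝕜] lp (fun _ : α => 𝕜) 2}
    (hT : ∀ i j, T (lp.single 2 j 1) i = 0) : T = 0 := by
  refine lp.ext_continuousLinearMap (by norm_num) fun j => ?_
  ext i
  exact hT i j

/-- Phillips–Sobczyk, in Whitley's proof: the kernel would be `c₀`. -/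
theorem not_forall_apply_eq_zero_iff_isCompactOperator_diagonalOp
    (Φ : lp (fun _ : ℕ => 𝕜) ∞ →L[ℝ] lp (fun _ : ℕ => 𝕜) 2 →L[𝕜] lp (fun _ : ℕ => 𝕜) 2) :
    ¬ ∀ a, Φ a = 0 ↔ IsCompactOperator (diagonalOp 𝕜 ℕ a) := by
  intro hΦ
  let coeff (k : ℕ × ℕ) : (lp (fun _ : ℕ => 𝕜) 2 →L[𝕜] lp (fun _ : ℕ => 𝕜) 2) →L[ℝ] 𝕜 :=
    (lp.evalCLM 𝕜 (fun _ => 𝕜) 2 k.1 ∘L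
      ContinuousLinearMap.apply 𝕜 _ (lp.single 2 k.2 1)).restrictScalars ℝ
  obtain ⟨S, hS, hΦS⟩ := exists_infinite_apply_boundedIndicator_eq_zero (ψ := coeff)
    (fun T hT => eq_zero_of_forall_apply_single_eq_zero fun i j => hT (i, j))
    fun a ha => (hΦ a).2 (isCompactOperator_diagonalOp_of_finite_support ha)
  exact not_isCompactOperator_diagonalOp_boundedIndicator hS ((hΦ _).1 hΦS)

theorem exists_linearIsometry_lp_two {E : Type*} [NormedAddCommGroup E] [InnerProductSpace 𝕜 E]
    [CompleteSpace E] (h : ¬ FiniteDimensional 𝕜 E) :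
    Nonempty (lp (fun _ : ℕ => 𝕜) 2 →ₗᵢ[𝕜] E) := by
  obtain ⟨w, b, -⟩ := exists_hilbertBasis 𝕜 E
  have hw : Infinite w := by
    by_contra hw
    rw [not_infinite_iff_finite] at hw
    have := Fintype.ofFinite w
    exact h b.toOrthonormalBasis.toBasis.finiteDimensional_of_finite
  have hv := b.orthonormal.comp _ (Infinite.natEmbedding w).injective
  exact ⟨hv.orthogonalFamily.linearIsometry⟩

end DiagonalOperators

section NotSplit

open scoped ENNReal

variable {H : Type u} [NormedAddCommGroup H] [InnerProductSpace ℂ H] [CompleteSpace H]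

theorem mul_mul_mem_offDiag {E : Type*} [NormedAddCommGroup E] [InnerProductSpace ℂ E]
    [CompleteSpace E] {p : Proj H} {J K : E →ₗᵢ[ℂ] H} (hJ : ∀ x, p.1 (J x) = J x)
    (hK : ∀ x, p.1 (K x) = 0) (T : E →L[ℂ] E) :
    K.toContinuousLinearMap ∘L T ∘L J.toContinuousLinearMap.adjoint ∈ offDiag p := by
  have hpJ : p.1 ∘L J.toContinuousLinearMap = J.toContinuousLinearMap :=
    ContinuousLinearMap.ext hJ
  have hJp : J.toContinuousLinearMap.adjoint ∘L p.1 = J.toContinuousLinearMap.adjoint := by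
    have h := congrArg ContinuousLinearMap.adjoint hpJ
    rwa [ContinuousLinearMap.adjoint_comp, p.2.isSelfAdjoint.adjoint_eq] at h
  change (1 - p.1) ∘L (_ ∘L T ∘L _) ∘L p.1 = _
  ext x
  have hx : J.toContinuousLinearMap.adjoint (p.1 x) = J.toContinuousLinearMap.adjoint x :=
    DFunLike.congr_fun hJp x
  change K _ - p.1 (K _) = K _
  rw [hK, sub_zero]
  exact congrArg (fun y => K (T y)) hx

theorem exists_linearIsometry_of_not_finiteDimensional_range {p : Proj H}
    (hrange : ¬ FiniteDimensional ℂ (LinearMap.range (p.1 : H →ₗ[ℂ] H))) :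
    ∃ J : lp (fun _ : ℕ => ℂ) 2 →ₗᵢ[ℂ] H, ∀ x, p.1 (J x) = J x := by
  have hidem : IsIdempotentElem p.1 := p.2.isIdempotentElem
  have : CompleteSpace (LinearMap.range (p.1 : H →ₗ[ℂ] H)) :=
    (ContinuousLinearMap.IsIdempotentElem.isClosed_range hidem).completeSpace_coe
  obtain ⟨J⟩ := exists_linearIsometry_lp_two hrange
  refine ⟨(LinearMap.range (p.1 : H →ₗ[ℂ] H)).subtypeₗᵢ.comp J, fun x => ?_⟩
  obtain ⟨y, hy⟩ := (J x).2
  change p.1 (J x : H) = J x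
  rw [← hy]
  exact DFunLike.congr_fun hidem.eq y

theorem exists_linearIsometry_of_not_finiteDimensional_ker {p : Proj H}
    (hker : ¬ FiniteDimensional ℂ (LinearMap.ker (p.1 : H →ₗ[ℂ] H))) :
    ∃ K : lp (fun _ : ℕ => ℂ) 2 →ₗᵢ[ℂ] H, ∀ x, p.1 (K x) = 0 := by
  have : CompleteSpace (LinearMap.ker (p.1 : H →ₗ[ℂ] H)) :=
    p.1.isClosed_ker.completeSpace_coe
  obtain ⟨K⟩ := exists_linearIsometry_lp_two hker
  exact ⟨(LinearMap.ker (p.1 : H →ₗ[ℂ] H)).subtypeₗᵢ.comp K, fun x => (K x).2⟩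

theorem not_hasLeftInverse_compactOffDiagInclusion {p : Proj H}
    (hrange : ¬ FiniteDimensional ℂ (LinearMap.range (p.1 : H →ₗ[ℂ] H)))
    (hker : ¬ FiniteDimensional ℂ (LinearMap.ker (p.1 : H →ₗ[ℂ] H))) :
    ¬ (compactOffDiagInclusion p).toContinuousLinearMap.HasLeftInverse := by
  rintro ⟨P, hP⟩
  obtain ⟨J, hJ⟩ := exists_linearIsometry_of_not_finiteDimensional_range hrange
  obtain ⟨K, hK⟩ := exists_linearIsometry_of_not_finiteDimensional_ker hker
  let D : lp (fun _ : ℕ => ℂ) ∞ →L[ℝ] offDiag p :=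
    ((K.toContinuousLinearMap.postcomp H ∘L J.toContinuousLinearMap.adjoint.precomp _ ∘L
      diagonalOp ℂ ℕ).restrictScalars ℝ).codRestrict (offDiag p) fun a =>
        mul_mul_mem_offDiag hJ hK _
  let compress : (H →L[ℂ] H) →L[ℝ] lp (fun _ : ℕ => ℂ) 2 →L[ℂ] lp (fun _ : ℕ => ℂ) 2 :=
    (K.toContinuousLinearMap.adjoint.postcomp _ ∘L
      J.toContinuousLinearMap.precomp H).restrictScalars ℝ
  have hcompress (a) : compress (D a) = diagonalOp ℂ ℕ a := by
    have hJJ := J.adjoint_comp_self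
    have hKK := K.adjoint_comp_self
    ext1 x
    change K.toContinuousLinearMap.adjoint (K (diagonalOp ℂ ℕ a
      (J.toContinuousLinearMap.adjoint (J x)))) = _
    exact (DFunLike.congr_fun hKK _).trans
      (congrArg (diagonalOp ℂ ℕ a) (DFunLike.congr_fun hJJ x))
  refine not_forall_apply_eq_zero_iff_isCompactOperator_diagonalOp
    (compress ∘L (offDiag p).subtypeL ∘L
      (.id ℝ _ - (compactOffDiagInclusion p).toContinuousLinearMap ∘L P) ∘L D) fun a => ⟨?_, ?_⟩
  · intro ha
    have hcompact : IsCompactOperator (compress (P (D a)).1) :=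
      ((P (D a)).2.2.comp_clm J.toContinuousLinearMap).clm_comp
        K.toContinuousLinearMap.adjoint
    have hsub : compress ((D a).1 - (P (D a)).1) = 0 := ha
    rw [map_sub, hcompress, sub_eq_zero] at hsub
    rwa [hsub]
  · intro ha
    have hDa : (D a).1 ∈ compactOffDiag p := ⟨(D a).2, (ha.comp_clm
      J.toContinuousLinearMap.adjoint).clm_comp K.toContinuousLinearMap⟩
    have hPD : P (D a) = ⟨(D a).1, hDa⟩ := hP ⟨(D a).1, hDa⟩
    change compress ((D a).1 - (P (D a)).1) = 0
    rw [hPD, sub_self, map_zero]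

variable {Hp : Submodule ℂ H} [Hp.HasOrthogonalProjection]

theorem starProjection_mem_resGrassmannian :
    (⟨Hp.starProjection, isStarProjection_starProjection⟩ : Proj H) ∈ resGrassmannian Hp := by
  constructor
  · have hproj : Hp.orthogonalProjectionOnto ∘L
        (LinearMap.range (Hp.starProjection : H →ₗ[ℂ] H)).subtypeL =
        (ContinuousLinearEquiv.ofEq _ _ Hp.range_starProjection : _ →L[ℂ] Hp) := by
      ext x
      exact Submodule.starProjection_eq_self_iff.2 (Hp.range_starProjection.le x.2)
    exact hproj ▸ isFredholm_continuousLinearEquiv _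
  · have hproj : Hpᗮ.orthogonalProjectionOnto ∘L
        (LinearMap.range (Hp.starProjection : H →ₗ[ℂ] H)).subtypeL = 0 :=
      Submodule.IsOrtho.orthogonalProjectionOnto_comp_subtypeL <| by
        rw [Hp.range_starProjection]
        exact Hp.isOrtho_orthogonal_left
    exact (congrArg (fun T : _ →L[ℂ] Hpᗮ => IsCompactOperator T) hproj).mpr
      isCompactOperator_zero

theorem not_hasLeftInverse_compactOffDiagInclusion_of_eq_starProjection {p : Proj H}
    (hpHp : p.1 = Hp.starProjection) (hp : ¬ FiniteDimensional ℂ Hp)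
    (hm : ¬ FiniteDimensional ℂ Hpᗮ) :
    ¬ (compactOffDiagInclusion p).toContinuousLinearMap.HasLeftInverse :=
  not_hasLeftInverse_compactOffDiagInclusion (by rwa [hpHp, Hp.range_starProjection])
    (by rwa [hpHp, Hp.ker_starProjection])

theorem not_isSplitImmersedSubmanifold_resGrassmannian
    (hp : ¬ FiniteDimensional ℂ Hp) (hm : ¬ FiniteDimensional ℂ Hpᗮ) :
    ¬ IsSplitImmersedSubmanifold
      (resGrassmannianAtlas Hp) (grassmannianAtlas H) Subtype.val := by
  intro h
  let p : {p // p ∈ resGrassmannian Hp} := ⟨_, starProjection_mem_resGrassmannian⟩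
  have hleft := (resGrassmannianSliceAtlas Hp).hasLeftInverse_of_isSplitImmersedSubmanifold
    (isLinearInCharts_resGrassmannian p) h
  exact not_hasLeftInverse_compactOffDiagInclusion_of_eq_starProjection rfl hp hm hleft

theorem hasLeftInverse_compactOffDiagInclusion_of_resModelInclusion {p q : Proj H}
    (h : (resModelInclusion p q).toContinuousLinearMap.HasLeftInverse) :
    (compactOffDiagInclusion p).toContinuousLinearMap.HasLeftInverse :=
  have hinl : (resModelInclusion p q).toContinuousLinearMap ∘L .inl ℝ _ _ =
      .inl ℝ _ _ ∘L (compactOffDiagInclusion p).toContinuousLinearMap := by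
    ext1 A
    exact Prod.ext rfl (map_zero ((compactOffDiagInclusion q).toLinearMap.prodMap .id))
  .of_comp (hinl ▸ h.comp .inl)

theorem not_isSplitImmersedSubmanifold_resPartialIsometry
    (hp : ¬ FiniteDimensional ℂ Hp) (hm : ¬ FiniteDimensional ℂ Hpᗮ) :
    ¬ IsSplitImmersedSubmanifold
      (resPartialIsometryAtlas Hp) (partialIsometryAtlas H) Subtype.val := by
  intro h
  let p : Proj H := ⟨Hp.starProjection, isStarProjection_starProjection⟩
  let u := (resPartialIsometryGroupoid Hp).unit ⟨p, starProjection_mem_resGrassmannian⟩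
  have hu : u.1.tgt.1 = Hp.starProjection :=
    congrArg Subtype.val ((partialIsometryGroupoid H).t_unit p)
  have hleft := hasLeftInverse_compactOffDiagInclusion_of_resModelInclusion <|
    (resPartialIsometrySliceAtlas Hp).hasLeftInverse_of_isSplitImmersedSubmanifold
      (isLinearInCharts_resPartialIsometry u) h
  exact not_hasLeftInverse_compactOffDiagInclusion_of_eq_starProjection hu hp hm hleft

end NotSplit

end

theorem mainTheorem5_general {H : Type u} [NormedAddCommGroup H] [InnerProductSpace ℂ H]
    [CompleteSpace H]
    (Hp : Submodule ℂ H) [Hp.HasOrthogonalProjection]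
    (hp : ¬ FiniteDimensional ℂ Hp) (hm : ¬ FiniteDimensional ℂ Hpᗮ) :
    (partialIsometryGroupoid H).IsBanachLieGroupoid
      (partialIsometryAtlas H) (grassmannianAtlas H) ∧
    (resPartialIsometryGroupoid Hp).IsBanachLieGroupoid
      (resPartialIsometryAtlas Hp) (resGrassmannianAtlas Hp) ∧
    (resPartialIsometryGroupoid Hp).IsHom (partialIsometryGroupoid H)
      Subtype.val Subtype.val ∧
    IsImmersedSubmanifold (resPartialIsometryAtlas Hp) (partialIsometryAtlas H) Subtype.val ∧
    IsImmersedSubmanifold (resGrassmannianAtlas Hp) (grassmannianAtlas H) Subtype.val ∧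
    ¬ IsSplitImmersedSubmanifold
        (resPartialIsometryAtlas Hp) (partialIsometryAtlas H) Subtype.val ∧
    ¬ IsSplitImmersedSubmanifold
        (resGrassmannianAtlas Hp) (grassmannianAtlas H) Subtype.val :=
  ⟨isBanachLieGroupoid_partialIsometryGroupoid,
    isBanachLieGroupoid_resPartialIsometryGroupoid,
    isHom_resPartialIsometryGroupoid,
    isImmersedSubmanifold_resPartialIsometry,
    isImmersedSubmanifold_resGrassmannian,
    not_isSplitImmersedSubmanifold_resPartialIsometry hp hm,
    not_isSplitImmersedSubmanifold_resGrassmannian hp hm⟩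

theorem mainTheorem5 {H : Type u} [NormedAddCommGroup H] [InnerProductSpace ℂ H] [CompleteSpace H]
    [TopologicalSpace.SeparableSpace H]
    (Hp : Submodule ℂ H) [Hp.HasOrthogonalProjection]
    (hp : ¬ FiniteDimensional ℂ Hp) (hm : ¬ FiniteDimensional ℂ Hpᗮ) :
    -- both are Banach Lie groupoids
    (partialIsometryGroupoid H).IsBanachLieGroupoid
      (partialIsometryAtlas H) (grassmannianAtlas H) ∧
    (resPartialIsometryGroupoid Hp).IsBanachLieGroupoid
      (resPartialIsometryAtlas Hp) (resGrassmannianAtlas Hp) ∧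
    -- the inclusions form a morphism of groupoids
    (resPartialIsometryGroupoid Hp).IsHom (partialIsometryGroupoid H)
      Subtype.val Subtype.val ∧
    -- they are immersed submanifolds, on arrows and on objects
    IsImmersedSubmanifold (resPartialIsometryAtlas Hp) (partialIsometryAtlas H) Subtype.val ∧
    IsImmersedSubmanifold (resGrassmannianAtlas Hp) (grassmannianAtlas H) Subtype.val ∧
    -- neither of them is split immersed
    ¬ IsSplitImmersedSubmanifold
        (resPartialIsometryAtlas Hp) (partialIsometryAtlas H) Subtype.val ∧
    ¬ IsSplitImmersedSubmanifold
        (resGrassmannianAtlas Hp) (grassmannianAtlas H) Subtype.val :=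
  mainTheorem5_general Hp hp hm
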